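/- Conventions. Let $X$ be a simplicial complex; $X_\sigma$ denotes the link of a simplex $\sigma$ in $X$. For $k\ge 4$, a simplicial complex is $k$-large if it is flag and every embedded cycle of length $m$ with $4\le m<k$ in its 1-skeleton has a diagonal (an edge joining two nonconsecutive vertices of the cycle). $X$ is $k$-systolic if it is connected, simply connected, and the link of every nonempty simplex is $k$-large. $X$ is a chamber complex of dimension $n$ if it is the union of its $n$-simplices and every $(n-1)$-simplex is a face of at least two $n$-simplices. For a subcomplex $Q$ of a complex $Y$, put $B_0(Q,Y)=Q$ and let $B_i(Q,Y)$ be the union of all closed simplices of $Y$ meeting $B_{i-1}(Q,Y)$; for $i\ge 1$ let $S_i(Q,Y)$ be the subcomplex of $B_i(Q,Y)$ spanned by the vertices not in $B_{i-1}(Q,Y)$, and let $\stackrel{\circ}{B_i}(Q,Y)=B_i(Q,Y)\setminus S_i(Q,Y)$. For a vertex $w$ of $X$, condition $R(w,X)$ says: for every nonempty simplex $\sigma$ of $X_w$, the spaces $X_w\setminus \stackrel{\circ}{B_2}(\sigma,X_w)$ and $X_w\setminus\stackrel{\circ}{B_3}(\sigma,X_w)$ are connected. The ideal (Gromov) boundary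 $\partial X$ is the set of geodesic rays in the 1-skeleton of $X$ issuing from a fixed base vertex $v$, modulo staying at bounded distance from each other, with the quotient of the topology of uniform convergence on compact sets. Theorem. Let $X$ be a locally finite $7$-systolic chamber complex of finite dimension $n\ge 2$ such that condition $R(w,X)$ holds for every vertex $w$ of $X$. Then the ideal boundary $\partial X$ of $X$ (taken from any base vertex) is connected (in particular nonempty). -/

import Mathlib

namespace PreAbstractSimplicialComplex

variable {V : Type*}

/-! ### Simplicial complexes: realization, 1-skeleton, links

A simplicial complex is given by its nonempty finite faces on a type `V`; its vertices are the
`v : V` with `{v} ∈ X.faces`, and need not exhaust `V`. -/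

/-- The geometric realization of `X`, in barycentric coordinates, as a subspace of `V → ℝ`.
On points with nonnegative coordinates of sum `1`, coordinatewise convergence is the same as
convergence in the `ℓ¹` metric, so this is the metric topology of the realization. For a locally
finite complex it is also the weak topology. -/
def space (X : PreAbstractSimplicialComplex V) : Set (V → ℝ) :=
  {x | ∃ s ∈ X.faces, (∀ v, 0 ≤ x v) ∧ (∀ v, v ∉ s → x v = 0) ∧ ∑ v ∈ s, x v = 1}

/-- The 1-skeleton of `X`, as a graph: two distinct elements are adjacent when they lie in a common
face. -/
def graph (X : PreAbstractSimplicialComplex V) : SimpleGraph V where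
  Adj u v := u ≠ v ∧ ∃ s ∈ X.faces, u ∈ s ∧ v ∈ s
  symm := ⟨fun _ _ h => ⟨h.1.symm, h.2.imp fun _ hs => ⟨hs.1, hs.2.2, hs.2.1⟩⟩⟩
  loopless := ⟨fun _ h => h.1 rfl⟩

/-- The link of `σ` in `X`: the faces disjoint from `σ` that span a face together with `σ`. -/
def link (X : PreAbstractSimplicialComplex V) (σ : Finset V) : PreAbstractSimplicialComplex V where
  faces := {t | t.Nonempty ∧ Disjoint σ t ∧ ∃ s ∈ X.faces, σ ⊆ s ∧ t ⊆ s}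
  isRelLowerSet_faces := fun _ ht =>
    ⟨ht.1, fun _ hrt hr => ⟨hr, ht.2.1.mono_right hrt,
      ht.2.2.imp fun _ hs => ⟨hs.1, hs.2.1, hrt.trans hs.2.2⟩⟩⟩

/-- The simplex `σ` with all its faces, as a complex. -/
def simplex (σ : Finset V) : PreAbstractSimplicialComplex V where
  faces := {t | t.Nonempty ∧ t ⊆ σ}
  isRelLowerSet_faces := fun _ ht => ⟨ht.1, fun _ hrt hr => ⟨hr, subset_trans hrt ht.2⟩⟩

/-! ### Combinatorial balls and spheres -/

/-- The closed combinatorial ball `B_i(Q, X)`: `B_0 = Q`, and `B_{i+1}` is the union of all closed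
simplices of `X` that meet `B_i`. -/
def ball (X Q : PreAbstractSimplicialComplex V) : ℕ → PreAbstractSimplicialComplex V
  | 0 => Q
  | i + 1 =>
    { faces := {s | s.Nonempty ∧ ∃ τ ∈ X.faces, s ⊆ τ ∧ ∃ u ∈ τ, {u} ∈ (ball X Q i).faces}
      isRelLowerSet_faces := fun _ ht => ⟨ht.1, fun _ hrt hr =>
        ⟨hr, ht.2.imp fun _ hs => ⟨hs.1, subset_trans hrt hs.2.1, hs.2.2⟩⟩⟩ }

/-- The combinatorial sphere `S_i(Q, X)`: the subcomplex of `B_i(Q, X)` spanned by the vertices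
that do not belong to `B_{i-1}(Q, X)`; by convention `S_0 = Q`. -/
def sphere (X Q : PreAbstractSimplicialComplex V) : ℕ → PreAbstractSimplicialComplex V
  | 0 => Q
  | i + 1 =>
    { faces := {s | s ∈ (ball X Q (i + 1)).faces ∧ ∀ u ∈ s, {u} ∉ (ball X Q i).faces}
      isRelLowerSet_faces := fun _ ht =>
        ⟨((ball X Q (i + 1)).isRelLowerSet_faces ht.1).1, fun _ hrt hr =>
          ⟨((ball X Q (i + 1)).isRelLowerSet_faces ht.1).2 hrt hr, fun u hu => ht.2 u (hrt hu)⟩⟩ }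

/-- The interior of the combinatorial ball, `B_i(Q, X) \ S_i(Q, X)`, as a set of points of the
realization. -/
def ballInterior (X Q : PreAbstractSimplicialComplex V) (i : ℕ) : Set (V → ℝ) :=
  (X.ball Q i).space \ (X.sphere Q i).space

/-! ### Systolic complexes -/

/-- `X` is flag: every nonempty finite set of pairwise adjacent vertices is a face. -/
def IsFlag (X : PreAbstractSimplicialComplex V) : Prop :=
  ∀ s : Finset V, s.Nonempty → (∀ v ∈ s, {v} ∈ X.faces) →
    (∀ u ∈ s, ∀ v ∈ s, u ≠ v → X.graph.Adj u v) → s ∈ X.faces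

/-- `X` is `k`-large: it is flag and every embedded cycle of length `m`, `4 ≤ m < k`, in the
1-skeleton has a diagonal. -/
def IsLarge (X : PreAbstractSimplicialComplex V) (k : ℕ) : Prop :=
  X.IsFlag ∧ ∀ m : ℕ, 4 ≤ m → m < k → ∀ c : ZMod m → V, Function.Injective c →
    (∀ i, X.graph.Adj (c i) (c (i + 1))) →
      ∃ i j, j ≠ i + 1 ∧ i ≠ j + 1 ∧ X.graph.Adj (c i) (c j)

/-- `X` is `k`-systolic: links of all (nonempty) simplices are `k`-large, and `X` is connected and
simply connected. -/
def IsSystolic (X : PreAbstractSimplicialComplex V) (k : ℕ) : Prop :=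
  (∀ σ ∈ X.faces, (X.link σ).IsLarge k) ∧ IsConnected X.space ∧ IsSimplyConnected X.space

/-- Every vertex lies in only finitely many simplices. -/
def IsLocallyFinite (X : PreAbstractSimplicialComplex V) : Prop :=
  ∀ v, {s ∈ X.faces | v ∈ s}.Finite

/-- `X` is a chamber complex of dimension `n`: it is the union of its `n`-simplices, and each
`(n-1)`-simplex is a face of at least two `n`-simplices. -/
def IsChamberComplex (X : PreAbstractSimplicialComplex V) (n : ℕ) : Prop :=
  (∀ s ∈ X.faces, ∃ t ∈ X.faces, t.card = n + 1 ∧ s ⊆ t) ∧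
  ∀ s ∈ X.faces, s.card = n → ∃ t₁ ∈ X.faces, ∃ t₂ ∈ X.faces,
    t₁ ≠ t₂ ∧ t₁.card = n + 1 ∧ t₂.card = n + 1 ∧ s ⊆ t₁ ∧ s ⊆ t₂

/-- The condition `R(v, X)`: for every simplex `σ` of the link `X_v`, the complements in `X_v` of
the interiors of the balls `B_2(σ, X_v)` and `B_3(σ, X_v)` are connected. -/
def ConditionR (X : PreAbstractSimplicialComplex V) (v : V) : Prop :=
  ∀ σ ∈ (X.link {v}).faces,
    IsConnected ((X.link {v}).space \ (X.link {v}).ballInterior (simplex σ) 2) ∧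
    IsConnected ((X.link {v}).space \ (X.link {v}).ballInterior (simplex σ) 3)

end PreAbstractSimplicialComplex

namespace SimpleGraph

variable {V : Type*}

/-! ### The ideal (Gromov) boundary of a graph, from a base vertex -/

/-- Geodesic rays in `G` starting at `v`, given by their sequences of vertices. -/
def GeodesicRay (G : SimpleGraph V) (v : V) : Type _ :=
  {c : ℕ → V // c 0 = v ∧ ∀ i j, G.dist (c i) (c (i + j)) = j}

/-- The topology of uniform convergence on compact (that is, finite) pieces: the product topology,
with `V` discrete. -/
instance (G : SimpleGraph V) (v : V) : TopologicalSpace (G.GeodesicRay v) :=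
  .induced Subtype.val (@Pi.topologicalSpace ℕ (fun _ => V) (fun _ => ⊥))

/-- Two rays are asymptotic if they stay at bounded distance from each other. -/
def asymptoticSetoid (G : SimpleGraph V) (v : V) : Setoid (G.GeodesicRay v) where
  r c d := ∃ D : ℕ, ∀ k, G.dist (c.1 k) (d.1 k) ≤ D
  iseqv :=
    { refl := fun _ => ⟨0, fun _ => by simp⟩
      symm := fun ⟨D, h⟩ => ⟨D, fun k => by rw [G.dist_comm]; exact h k⟩
      trans := by
        rintro a b c ⟨D, h⟩ ⟨E, h'⟩
        have key : ∀ (x : G.GeodesicRay v) (k : ℕ), G.Reachable v (x.1 k) := by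
          intro x k
          rcases Nat.eq_zero_or_pos k with rfl | hk
          · rw [x.2.1]
          · have hx := x.2.2 0 k
            rw [zero_add, x.2.1] at hx
            exact Reachable.of_dist_ne_zero (by omega)
        refine ⟨D + E, fun k => ?_⟩
        have h1 := ((key a k).symm.trans (key b k)).dist_triangle_left (w := c.1 k)
        have h2 := h k
        have h3 := h' k
        omega }

/-- The ideal boundary: asymptote classes of geodesic rays from `v`, with the quotient topology. -/
def IdealBoundary (G : SimpleGraph V) (v : V) : Type _ :=
  Quotient (G.asymptoticSetoid v)

instance (G : SimpleGraph V) (v : V) : TopologicalSpace (G.IdealBoundary v) :=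
  inferInstanceAs (TopologicalSpace (Quotient (G.asymptoticSetoid v)))

end SimpleGraph

/-! Fix a base vertex `v`. Starting from `v`, one builds sphere by sphere a complex over `X`, using
only largeness of the vertex links (`Good.next`). It is a combinatorial covering of `X`
(`Dev.isCovering`). Simple connectedness makes the projection injective
(`IsCovering.eq_of_reflTransGen`) and connectedness makes it surjective on vertices, so the sphere
number becomes a function `l` on the vertices of `X`. This is the distance from `v`, and it has the
usual convexity properties: lower neighbours of a vertex form a clique, and adjacent vertices of a
sphere have a common lower neighbour (`exists_isLevel`).

Largeness up to hexagons gives more: of two adjacent vertices of a sphere, one sees all lower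
neighbours of the other (`IsLevel.nested`). Hence two rays from `v` that are adjacent or equal at
one level are so at every earlier level (`IsLevel.edge_of_le`).

Spheres of positive radius are connected (`IsLevel.sphere_connected`). By condition `R`, the upper
neighbours of a vertex are joined to each other inside their sphere; by the chamber condition,
adjacent vertices of a sphere have a common upper neighbour. So a path in one sphere lifts to a path
in the next.

Finally, suppose the boundary splits into two nonempty clopen pieces. Every vertex lies on a ray, so
walking along a sphere produces, for each radius, two rays adjacent or equal there but in different
pieces. The space of rays is compact, so a limiting pair is adjacent or equal at all levels: its
members are asymptotic yet lie in different pieces, which is absurd. -/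

/-! ### Monodromy -/

namespace PreAbstractSimplicialComplex

open Set unitInterval

variable {V : Type*}

/-- Two (possibly equal) vertices lie in a common face. -/
def Edge (X : PreAbstractSimplicialComplex V) (a b : V) : Prop :=
  ∃ s ∈ X.faces, a ∈ s ∧ b ∈ s

/-- Three (possibly equal) vertices lie in a common face. -/
def Triangle (X : PreAbstractSimplicialComplex V) (a b c : V) : Prop :=
  ∃ s ∈ X.faces, a ∈ s ∧ b ∈ s ∧ c ∈ s

/-- A relation `R` on `Y` exhibits `f : Y → V` as a combinatorial covering of `X`: edges lift
uniquely, and so do triangles. -/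
structure IsCovering (X : PreAbstractSimplicialComplex V) {Y : Type*} (f : Y → V)
    (R : Y → Y → Prop) : Prop where
  refl : ∀ y, R y y
  symm : ∀ {y y'}, R y y' → R y' y
  edge : ∀ {y y'}, R y y' → X.Edge (f y) (f y')
  lift : ∀ {y b}, X.Edge (f y) b → ∃ y', R y y' ∧ f y' = b
  eq : ∀ {y y'}, R y y' → f y = f y' → y = y'
  triangle : ∀ {y y₁ y₂}, R y y₁ → R y y₂ → X.Triangle (f y) (f y₁) (f y₂) → R y₁ y₂

theorem face_of_mem_space {X : PreAbstractSimplicialComplex V} {x : V → ℝ} (hx : x ∈ X.space) :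
    ∃ s ∈ X.faces, ∀ u, 0 < x u → u ∈ s := by
  obtain ⟨s, hs, -, h0, -⟩ := hx
  refine ⟨s, hs, fun u hu => ?_⟩
  by_contra h
  exact hu.ne' (h0 u h)

theorem exists_pos_of_mem_space {X : PreAbstractSimplicialComplex V} {x : V → ℝ}
    (hx : x ∈ X.space) : ∃ u, 0 < x u := by
  obtain ⟨s, -, hn, -, h1⟩ := hx
  by_contra! h
  have : ∑ v ∈ s, x v ≤ 0 := Finset.sum_nonpos fun v _ => h v
  linarith

/-- Discrete homotopy lifting: each row is lifted vertically from the row before, and `triangle`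
makes the lifts an edge path again. The endpoints do not move because edges over a single vertex are
trivial. The last row is constant below, hence constant above. -/
theorem IsCovering.grid {X : PreAbstractSimplicialComplex V} {Y : Type*} {f : Y → V}
    {R : Y → Y → Prop} (C : X.IsCovering f R) {u : ℕ → ℕ → V} {a : V} {N : ℕ}
    (hu : ∀ i j, ∃ s ∈ X.faces, u i j ∈ s ∧ u (i + 1) j ∈ s ∧ u i (j + 1) ∈ s ∧
      u (i + 1) (j + 1) ∈ s)
    (h0 : ∀ j, u 0 j = a) (hN : ∀ j, u N j = a) (hT : ∀ i, u i N = a)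
    {y : ℕ → Y} (hy : ∀ i, f (y i) = u i 0) (hR : ∀ i, R (y i) (y (i + 1))) : y 0 = y N := by
  have rows : ∀ j, ∃ z : ℕ → Y, (∀ i, f (z i) = u i j) ∧ (∀ i, R (z i) (z (i + 1))) ∧
      z 0 = y 0 ∧ z N = y N := by
    intro j
    induction j with
    | zero => exact ⟨y, hy, hR, rfl, rfl⟩
    | succ j ih =>
      obtain ⟨z, hz, hzR, hz0, hzN⟩ := ih
      have hl : ∀ i, ∃ z', R (z i) z' ∧ f z' = u i (j + 1) := by
        intro i
        obtain ⟨s, hs, h1, -, h2, -⟩ := hu i j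
        exact C.lift ⟨s, hs, by rwa [hz], h2⟩
      choose z' hz' hfz' using hl
      refine ⟨z', hfz', fun i => ?_, ?_, ?_⟩
      · obtain ⟨s, hs, h1, h2, h3, h4⟩ := hu i j
        have e1 : R (z' i) (z (i + 1)) := by
          refine C.triangle (hz' i) (hzR i) ⟨s, hs, ?_⟩
          rw [hz, hz, hfz']; exact ⟨h1, h3, h2⟩
        refine C.triangle (C.symm e1) (hz' (i + 1)) ⟨s, hs, ?_⟩
        rw [hz, hfz', hfz']; exact ⟨h2, h3, h4⟩
      · rw [← hz0]; exact (C.eq (hz' 0) (by rw [hz, hfz', h0, h0])).symm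
      · rw [← hzN]; exact (C.eq (hz' N) (by rw [hz, hfz', hN, hN])).symm
  obtain ⟨z, hz, hzR, hz0, hzN⟩ := rows N
  have hc : ∀ i, z 0 = z i := by
    intro i
    induction i with
    | zero => rfl
    | succ i ih => rw [ih]; exact C.eq (hzR i) (by rw [hz, hz, hT, hT])
  rw [← hz0, ← hzN, hc N]

/-! ### Edge paths as paths in the realization -/

/-- The hat function around `k`. -/
noncomputable def hat (x : ℝ) (k : ℕ) : ℝ := max 0 (1 - |x - k|)

theorem hat_nonneg (x : ℝ) (k : ℕ) : 0 ≤ hat x k := le_max_left _ _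

theorem hat_pos_iff {x : ℝ} {k : ℕ} : 0 < hat x k ↔ |x - k| < 1 := by
  simp [hat]

theorem sum_hat (m : ℕ) (x : ℝ) (h0 : 0 ≤ x) (hm : x ≤ m) :
    ∑ k ∈ Finset.range (m + 1), hat x k = 1 := by
  induction m with
  | zero =>
    have : x = 0 := le_antisymm (by simpa using hm) h0
    simp [hat, this]
  | succ m ih =>
    rw [Finset.sum_range_succ]
    by_cases h : x ≤ m
    · rw [ih h]
      have : hat x (m + 1) = 0 := by
        refine max_eq_left ?_
        rw [abs_of_nonpos] <;> push_cast <;> linarith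
      rw [this, add_zero]
    · push Not at h
      rw [Finset.sum_range_succ, Finset.sum_eq_zero]
      · push_cast at hm
        have h1 : hat x m = 1 - (x - m) := by
          rw [hat, abs_of_pos (by linarith)]; exact max_eq_right (by linarith)
        have h2 : hat x (m + 1) = 1 + (x - (m + 1)) := by
          rw [hat, abs_of_nonpos (by push_cast; linarith)]
          rw [max_eq_right] <;> push_cast <;> linarith
        rw [h1, h2]; ring
      · intro k hk
        have hk' : (k : ℝ) + 1 ≤ m := by exact_mod_cast Finset.mem_range.mp hk
        refine max_eq_left ?_
        rw [abs_of_pos (by linarith)]; linarith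

/-- The point of the realization of the edge path `a` at time `x`. -/
noncomputable def polygon (a : ℕ → V) (m : ℕ) (x : ℝ) : V → ℝ := by
  classical
  exact fun v => ∑ k ∈ Finset.range (m + 1), if a k = v then hat x k else 0

theorem polygon_pos_iff {a : ℕ → V} {m : ℕ} {x : ℝ} {v : V} :
    0 < polygon a m x v ↔ ∃ k ≤ m, a k = v ∧ |x - k| < 1 := by
  classical
  have h0 : ∀ k ∈ Finset.range (m + 1), 0 ≤ (if a k = v then hat x k else 0) := fun k _ => by
    split_ifs
    · exact hat_nonneg x k
    · exact le_rfl
  unfold polygon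
  rw [(Finset.sum_nonneg h0).lt_iff_ne, ne_comm, Ne, Finset.sum_eq_zero_iff_of_nonneg h0]
  push Not
  constructor
  · rintro ⟨k, hk, h⟩
    by_cases hkv : a k = v
    · rw [if_pos hkv] at h
      exact ⟨k, by simpa [Nat.lt_succ_iff] using hk, hkv,
        hat_pos_iff.mp (lt_of_le_of_ne (hat_nonneg _ _) h.symm)⟩
    · simp [hkv] at h
  · rintro ⟨k, hk, hkv, h⟩
    exact ⟨k, by simpa [Nat.lt_succ_iff] using hk, by
      rw [if_pos hkv]; exact (hat_pos_iff.mpr h).ne'⟩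

theorem polygon_mem_space {X : PreAbstractSimplicialComplex V} {a : ℕ → V} {m : ℕ}
    (ha : ∀ k, X.Edge (a k) (a (k + 1))) {x : ℝ} (h0 : 0 ≤ x) (hm : x ≤ m) :
    polygon a m x ∈ X.space := by
  classical
  have hnn : ∀ v, 0 ≤ polygon a m x v := fun v => Finset.sum_nonneg fun k _ => by
    split_ifs
    · exact hat_nonneg x k
    · exact le_rfl
  obtain ⟨s, hs, hs1, hs2⟩ := ha ⌊x⌋₊
  -- Only the hats centred at the floor of `x` and at the next integer can be nonzero.
  have hmem : ∀ k : ℕ, |x - k| < 1 → a k ∈ s := by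
    intro k hk
    rw [abs_lt] at hk
    have h1 := Nat.floor_le h0
    have h2 := Nat.lt_floor_add_one x
    have h3 : (k : ℝ) < ⌊x⌋₊ + 2 := by linarith
    have h4 : (⌊x⌋₊ : ℝ) < k + 1 := by linarith
    have h3' : k < ⌊x⌋₊ + 2 := by exact_mod_cast h3
    have h4' : ⌊x⌋₊ < k + 1 := by exact_mod_cast h4
    rcases (show k = ⌊x⌋₊ ∨ k = ⌊x⌋₊ + 1 by omega) with h | h <;> rw [h] <;> assumption
  refine ⟨s, hs, hnn, fun v hv => ?_, ?_⟩
  · by_contra h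
    obtain ⟨k, -, rfl, hk⟩ := polygon_pos_iff.mp (lt_of_le_of_ne (hnn v) (Ne.symm h))
    exact hv (hmem k hk)
  · unfold polygon
    rw [Finset.sum_comm]
    rw [← sum_hat m x h0 hm]
    refine Finset.sum_congr rfl fun k _ => ?_
    rw [Finset.sum_ite_eq]
    split_ifs with h
    · rfl
    · by_contra hne
      exact h (hmem k (hat_pos_iff.mp (lt_of_le_of_ne (hat_nonneg _ _) hne)))

theorem continuous_polygon (a : ℕ → V) (m : ℕ) : Continuous (polygon a m) := by
  classical
  refine continuous_pi fun v => continuous_finsetSum _ fun k _ => ?_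
  split_ifs
  · unfold hat; fun_prop
  · exact continuous_const

/-- The edge path below is contracted in the realization. A fine subdivision of the homotopy square
sends each cell into one open vertex star, and the chosen star centres form a grid to which `grid`
applies. -/
theorem IsCovering.eq_of_closed {X : PreAbstractSimplicialComplex V} (hX : IsSimplyConnected X.space)
    {Y : Type*} {f : Y → V} {R : Y → Y → Prop} (C : X.IsCovering f R) {m : ℕ} {e : ℕ → Y}
    (he : ∀ k, R (e k) (e (k + 1))) (hclosed : f (e 0) = f (e m)) : e 0 = e m := by
  classical
  have hedge : ∀ k, X.Edge (f (e k)) (f (e (k + 1))) := fun k => C.edge (he k)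
  set a : ℕ → V := fun k => f (e k) with ha
  set p : I → V → ℝ := fun t => polygon a m (m * t) with hp
  have hpmem : ∀ t, p t ∈ X.space := fun t =>
    polygon_mem_space hedge (mul_nonneg (Nat.cast_nonneg _) t.2.1)
      (mul_le_of_le_one_right (Nat.cast_nonneg _) t.2.2)
  have hpcont : Continuous p := (continuous_polygon a m).comp (by fun_prop)
  -- the lifts of `e` over a point of the path
  let L : I → Y → Prop := fun t y => ∃ k ≤ m, e k = y ∧ |(m * t : ℝ) - k| < 1
  have hLR : ∀ {t y y'}, L t y → L t y' → R y y' := by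
    rintro t _ _ ⟨k, -, rfl, hk⟩ ⟨l, -, rfl, hl⟩
    rw [abs_lt] at hk hl
    have h3 : (k : ℝ) < l + 2 := by linarith
    have h4 : (l : ℝ) < k + 2 := by linarith
    have h3' : k < l + 2 := by exact_mod_cast h3
    have h4' : l < k + 2 := by exact_mod_cast h4
    rcases (show k = l ∨ k = l + 1 ∨ l = k + 1 by omega) with h | h | h
    · rw [h]; exact C.refl _
    · rw [h]; exact C.symm (he l)
    · rw [h]; exact he k
  have hLpos : ∀ {t v}, 0 < p t v → ∃ y, L t y ∧ f y = v := by
    intro t v h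
    obtain ⟨k, hk, hkv, h⟩ := polygon_pos_iff.mp h
    exact ⟨e k, ⟨k, hk, rfl, h⟩, hkv⟩
  have hL0 : ∀ {y}, L 0 y → y = e 0 := by
    rintro y ⟨k, -, rfl, hk⟩
    simp only [Set.Icc.coe_zero, mul_zero, zero_sub, abs_neg, Nat.abs_cast] at hk
    have : k = 0 := by exact_mod_cast Nat.lt_one_iff.mp (by exact_mod_cast hk)
    rw [this]
  have hL1 : ∀ {y}, L 1 y → y = e m := by
    rintro y ⟨k, hkm, rfl, hk⟩
    simp only [Set.Icc.coe_one, mul_one] at hk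
    rw [abs_lt] at hk
    have : (m : ℝ) < k + 1 := by linarith
    have : m < k + 1 := by exact_mod_cast this
    rw [show k = m by omega]
  have hLopen : ∀ y, IsOpen {t | L t y} := by
    intro y
    have : {t : I | L t y} = ⋃ k : ℕ, ⋃ (_ : k ≤ m ∧ e k = y), {t : I | |(m * t : ℝ) - k| < 1} := by
      ext t; simp [L, and_assoc]
    rw [this]
    refine isOpen_iUnion fun k => isOpen_iUnion fun _ => ?_
    exact isOpen_lt (by fun_prop) continuous_const
  -- While the path stays in the open star of `v`, its lift over `v` cannot jump: at each time there
  -- is exactly one such lift, and each lift is present on an open set of times.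
  have hLconst : ∀ {J : Set I} (_ : IsPreconnected J) {v}, (∀ t ∈ J, 0 < p t v) →
      J.Nonempty → ∃ y, f y = v ∧ ∀ t ∈ J, L t y := by
    intro J hJ v hv ⟨t₀, ht₀⟩
    obtain ⟨y, hy, rfl⟩ := hLpos (hv t₀ ht₀)
    refine ⟨y, rfl, ?_⟩
    by_contra! hcon
    obtain ⟨t₁, ht₁, hnot⟩ := hcon
    have hO : IsOpen {t | ∃ z, z ≠ y ∧ f z = f y ∧ L t z} := by
      have : {t : I | ∃ z, z ≠ y ∧ f z = f y ∧ L t z} =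
          ⋃ z : Y, ⋃ (_ : z ≠ y ∧ f z = f y), {t : I | L t z} := by
        ext t; simp [and_assoc]
      rw [this]
      exact isOpen_iUnion fun z => isOpen_iUnion fun _ => hLopen z
    have h1 : ∀ t ∈ J, t ∈ {t | L t y} ∪ {t | ∃ z, z ≠ y ∧ f z = f y ∧ L t z} := by
      intro t ht
      obtain ⟨z, hz, hzy⟩ := hLpos (hv t ht)
      by_cases h : z = y
      · left; rw [h] at hz; exact hz
      · right; exact ⟨z, h, hzy, hz⟩
    obtain ⟨t, -, h2, z, hzy, hfz, hz⟩ := hJ _ _ (hLopen y) hO h1 ⟨t₀, ht₀, hy⟩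
      ⟨t₁, ht₁, (h1 t₁ ht₁).resolve_left hnot⟩
    exact hzy (C.eq (hLR hz h2) hfz)
  -- the closed path and its contraction
  have h01 : p 0 = p 1 := by
    funext v
    have e0 : p 0 v = if a 0 = v then 1 else 0 := by
      simp only [hp, polygon, Set.Icc.coe_zero, mul_zero]
      rw [Finset.sum_eq_single 0]
      · simp [hat]
      · intro k _ hk
        have : (1 : ℝ) ≤ k := by exact_mod_cast Nat.one_le_iff_ne_zero.mpr hk
        simp [hat, this]
      · simp
    have e1 : p 1 v = if a m = v then 1 else 0 := by
      simp only [hp, polygon, Set.Icc.coe_one, mul_one]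
      rw [Finset.sum_eq_single m]
      · simp [hat]
      · intro k hk hkm
        have h1 : k + 1 ≤ m := by
          have := Finset.mem_range.mp hk; omega
        have : (k : ℝ) + 1 ≤ m := by exact_mod_cast h1
        have : hat m k = 0 := by
          refine max_eq_left ?_
          rw [abs_of_pos (by linarith)]; linarith
        simp [this]
      · simp
    rw [e0, e1, show a 0 = a m from hclosed]
  let x₀ : X.space := ⟨p 0, hpmem 0⟩
  let γ : Path x₀ x₀ :=
    { toFun := fun t => ⟨p t, hpmem t⟩
      continuous_toFun := hpcont.subtype_mk _
      source' := rfl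
      target' := Subtype.ext h01.symm }
  have hsc := hX.simplyConnectedSpace
  obtain ⟨F⟩ := SimplyConnectedSpace.paths_homotopic γ (Path.refl x₀)
  have hstar : ∀ v : V, IsOpen {q : I × I | 0 < (F q).1 v} := fun v =>
    isOpen_lt continuous_const
      ((continuous_apply v).comp (continuous_subtype_val.comp (map_continuous F)))
  obtain ⟨t, ht0, htm, ⟨N, hN⟩, hcov⟩ :=
    exists_monotone_Icc_subset_open_cover_unitInterval_prod_self hstar (by
      intro q _
      obtain ⟨v, hv⟩ := exists_pos_of_mem_space (F q).2
      exact mem_iUnion.mpr ⟨v, hv⟩)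
  -- The indices are swapped because the first coordinate of `F` is the homotopy time; `i` runs
  -- along the path.
  choose u hu using fun i j => hcov j i
  have hpos : ∀ i j {r s : I}, t i ≤ r → r ≤ t (i + 1) → t j ≤ s → s ≤ t (j + 1) →
      0 < (F (s, r)).1 (u i j) := fun i j r s h1 h2 h3 h4 =>
    hu i j ⟨⟨h3, h4⟩, h1, h2⟩
  have hbase : ∀ {v}, 0 < p 0 v → v = a 0 := by
    intro v hv
    obtain ⟨y, hy, rfl⟩ := hLpos hv
    rw [hL0 hy]
  have step : ∀ i, t i ≤ t (i + 1) := fun i => htm (Nat.le_succ i)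
  have hlift : ∀ i, ∃ y, f y = u i 0 ∧ ∀ r ∈ Icc (t i) (t (i + 1)), L r y := by
    intro i
    refine hLconst isPreconnected_Icc (fun r hr => ?_) (nonempty_Icc.mpr (step i))
    have := hpos i 0 hr.1 hr.2 le_rfl (step 0)
    rw [ht0, F.apply_zero] at this
    exact this
  choose y hy hyL using hlift
  have key := C.grid (u := u) (a := a 0) (N := N) (y := y) ?_ ?_ ?_ ?_ hy ?_
  · have e0 : y 0 = e 0 := hL0 (by
      have := hyL 0 (t 0) ⟨le_rfl, step 0⟩
      rwa [ht0] at this)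
    have eN : y N = e m := hL1 (by
      have := hyL N (t N) ⟨le_rfl, step N⟩
      rwa [hN N le_rfl] at this)
    rw [← e0, ← eN, key]
  · intro i j
    -- Four neighbouring cells share a corner, so their four star centres all lie in the carrier of
    -- its image.
    obtain ⟨s, hs, h⟩ := face_of_mem_space (F (t (j + 1), t (i + 1))).2
    exact ⟨s, hs, h _ (hpos i j (step _) le_rfl (step _) le_rfl),
      h _ (hpos (i + 1) j le_rfl (step _) (step _) le_rfl),
      h _ (hpos i (j + 1) (step _) le_rfl le_rfl (step _)),
      h _ (hpos (i + 1) (j + 1) le_rfl (step _) le_rfl (step _))⟩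
  · intro j
    have := hpos 0 j le_rfl (step 0) le_rfl (step j)
    rw [ht0, F.source] at this
    exact hbase this
  · intro j
    have := hpos N j le_rfl (step N) le_rfl (step j)
    rw [hN N le_rfl, F.target] at this
    exact hbase this
  · intro i
    have := hpos i N le_rfl (step i) le_rfl (step N)
    rw [hN N le_rfl, F.apply_one] at this
    exact hbase this
  · exact fun i => hLR (hyL i (t (i + 1)) ⟨step i, le_rfl⟩)
      (hyL (i + 1) (t (i + 1)) ⟨le_rfl, step (i + 1)⟩)

/-- A set `A` of vertices meeting the support of every point of a preconnected set `D` is joined up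
by the edges inside `A`, if `A` contains those supports. -/
theorem reflTransGen_of_isPreconnected {X : PreAbstractSimplicialComplex V} {D : Set (V → ℝ)}
    (hD : IsPreconnected D) (hDX : D ⊆ X.space) {A : Set V}
    (hsupp : ∀ x ∈ D, ∀ u, 0 < x u → u ∈ A) {a b : V}
    (ha : ∃ x ∈ D, 0 < x a) (hb : ∃ x ∈ D, 0 < x b) :
    Relation.ReflTransGen (fun u w => u ∈ A ∧ w ∈ A ∧ X.Edge u w) a b := by
  by_contra hcon
  -- The points with a positive coordinate in `K`, and those with one outside `K`, form an open
  -- cover of `D`. A point in both has a carrier with an edge leaving `K`.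
  let K : Set V := {u | Relation.ReflTransGen (fun u w => u ∈ A ∧ w ∈ A ∧ X.Edge u w) a u}
  have hO : ∀ K : Set V, IsOpen {x : V → ℝ | ∃ u ∈ K, 0 < x u} := by
    intro K
    have : {x : V → ℝ | ∃ u ∈ K, 0 < x u} = ⋃ u ∈ K, {x : V → ℝ | 0 < x u} := by ext; simp
    rw [this]
    exact isOpen_biUnion fun u _ => isOpen_lt continuous_const (continuous_apply u)
  obtain ⟨xa, hxa, ha⟩ := ha
  obtain ⟨xb, hxb, hb⟩ := hb
  obtain ⟨x, hx, ⟨u, hu, hxu⟩, w, hw, hxw⟩ := hD _ _ (hO K) (hO Kᶜ) (fun x hx => by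
    obtain ⟨u, hu⟩ := exists_pos_of_mem_space (hDX hx)
    by_cases h : u ∈ K
    · exact Or.inl ⟨u, h, hu⟩
    · exact Or.inr ⟨u, h, hu⟩) ⟨xa, hxa, a, Relation.ReflTransGen.refl, ha⟩ ⟨xb, hxb, b, hcon, hb⟩
  obtain ⟨s, hs, h⟩ := face_of_mem_space (hDX hx)
  exact hw (Relation.ReflTransGen.tail hu ⟨hsupp x hx u hxu, hsupp x hx w hxw, s, hs, h u hxu, h w hxw⟩)

end PreAbstractSimplicialComplex

/-! ### Local largeness -/

namespace PreAbstractSimplicialComplex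

variable {V : Type*} {X : PreAbstractSimplicialComplex V}

theorem face_mono {s t : Finset V} (hs : s ∈ X.faces) (hts : t ⊆ s) (ht : t.Nonempty) :
    t ∈ X.faces :=
  (X.isRelLowerSet_faces hs).2 hts ht

theorem Edge.symm {a b : V} (h : X.Edge a b) : X.Edge b a :=
  let ⟨s, hs, ha, hb⟩ := h; ⟨s, hs, hb, ha⟩

theorem Edge.left {a b : V} (h : X.Edge a b) : {a} ∈ X.faces :=
  let ⟨_, hs, ha, _⟩ := h
  face_mono hs (Finset.singleton_subset_iff.mpr ha) (Finset.singleton_nonempty a)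

theorem Edge.right {a b : V} (h : X.Edge a b) : {b} ∈ X.faces := h.symm.left

theorem edge_self {a : V} (h : {a} ∈ X.faces) : X.Edge a a :=
  ⟨_, h, Finset.mem_singleton_self a, Finset.mem_singleton_self a⟩

theorem Edge.triangle {a b : V} (h : X.Edge a b) : X.Triangle a b b :=
  let ⟨s, hs, ha, hb⟩ := h; ⟨s, hs, ha, hb, hb⟩

theorem Triangle.swap {a b c : V} (h : X.Triangle a b c) : X.Triangle b a c :=
  let ⟨s, hs, ha, hb, hc⟩ := h; ⟨s, hs, hb, ha, hc⟩

theorem Triangle.flip {a b c : V} (h : X.Triangle a b c) : X.Triangle a c b :=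
  let ⟨s, hs, ha, hb, hc⟩ := h; ⟨s, hs, ha, hc, hb⟩

theorem Triangle.edge {a b c : V} (h : X.Triangle a b c) : X.Edge a b :=
  let ⟨s, hs, ha, hb, _⟩ := h; ⟨s, hs, ha, hb⟩

theorem Triangle.edge' {a b c : V} (h : X.Triangle a b c) : X.Edge a c := h.flip.edge

theorem link_edge_iff {w a b : V} :
    (X.link {w}).Edge a b ↔ a ≠ w ∧ b ≠ w ∧ X.Triangle w a b := by
  classical
  constructor
  · rintro ⟨s, ⟨-, hd, t, ht, hw, hst⟩, ha, hb⟩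
    rw [Finset.disjoint_singleton_left] at hd
    exact ⟨fun h => hd (h ▸ ha), fun h => hd (h ▸ hb), t, ht, by simpa using hw, hst ha, hst hb⟩
  · rintro ⟨ha, hb, t, ht, hw, hat, hbt⟩
    refine ⟨{a, b}, ⟨by simp, ?_, t, ht, by simpa using hw, ?_⟩, by simp, by simp⟩
    · rw [Finset.disjoint_singleton_left]; simp [ha.symm, hb.symm]
    · intro x hx; simp at hx; rcases hx with rfl | rfl <;> assumption

theorem link_vertex_iff {w a : V} : {a} ∈ (X.link {w}).faces ↔ a ≠ w ∧ X.Edge w a := by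
  constructor
  · intro h
    have := link_edge_iff.mp (edge_self h)
    exact ⟨this.1, this.2.2.edge⟩
  · rintro ⟨h, h'⟩
    exact (link_edge_iff.mpr ⟨h, h, h'.triangle⟩).left

/-- All links of vertices are `7`-large. -/
def LocallyLarge (X : PreAbstractSimplicialComplex V) : Prop :=
  ∀ w, {w} ∈ X.faces → (X.link {w}).IsLarge 7

/-- Flagness of the link of `w`, applied to `s` with `w` removed; flagness of `X` itself is not
available yet. -/
theorem LocallyLarge.face_of_pairwise (H : X.LocallyLarge) {s : Finset V} {w : V} (hw : w ∈ s)
    (h : ∀ a ∈ s, ∀ b ∈ s, X.Triangle w a b) : s ∈ X.faces := by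
  classical
  by_cases hs : (s.erase w).Nonempty
  · have hwX := (h w hw w hw).edge.left
    have := (H w hwX).1 (s.erase w) hs (fun a ha => link_vertex_iff.mpr
      ⟨Finset.ne_of_mem_erase ha, (h a (Finset.mem_of_mem_erase ha) w hw).edge⟩)
      (fun a ha b hb hab => ⟨hab, link_edge_iff.mpr ⟨Finset.ne_of_mem_erase ha,
        Finset.ne_of_mem_erase hb, h a (Finset.mem_of_mem_erase ha) b (Finset.mem_of_mem_erase hb)⟩⟩)
    obtain ⟨-, -, t, ht, hwt, hst⟩ := this
    refine face_mono ht (fun a ha => ?_) ⟨w, hw⟩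
    by_cases haw : a = w
    · rw [haw]; simpa using hwt
    · exact hst (Finset.mem_erase.mpr ⟨haw, ha⟩)
  · have : s = {w} := by
      rw [Finset.not_nonempty_iff_eq_empty] at hs
      rw [← Finset.insert_erase hw, hs, insert_empty_eq]
    rw [this]
    exact (h w hw w hw).edge.left

theorem LocallyLarge.tetrahedron (H : X.LocallyLarge) {w a b c : V} (hab : X.Triangle w a b)
    (hbc : X.Triangle w b c) (hac : X.Triangle w a c) :
    ∃ s ∈ X.faces, w ∈ s ∧ a ∈ s ∧ b ∈ s ∧ c ∈ s := by
  classical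
  refine ⟨{w, a, b, c}, H.face_of_pairwise (w := w) (by simp) ?_, by simp, by simp, by simp, by simp⟩
  have hww := hab.edge.left
  intro x hx y hy
  simp only [Finset.mem_insert, Finset.mem_singleton] at hx hy
  rcases hx with rfl | rfl | rfl | rfl <;> rcases hy with rfl | rfl | rfl | rfl <;>
    first
      | assumption
      | exact (edge_self hww).triangle
      | exact hab.flip
      | exact hbc.flip
      | exact hac.flip
      | exact hab.edge.triangle
      | exact hab.edge'.triangle
      | exact hac.edge'.triangle
      | exact hab.edge.triangle.swap.flip.swap
      | exact hab.edge.symm.triangle.swap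
      | exact hab.edge'.symm.triangle.swap
      | exact hac.edge'.symm.triangle.swap
      | exact hab.edge.symm.triangle.swap.flip
      | exact hab.edge'.symm.triangle.swap.flip
      | exact hac.edge'.symm.triangle.swap.flip

theorem LocallyLarge.triangle_of_tetrahedron (H : X.LocallyLarge) {w a b c : V}
    (hab : X.Triangle w a b) (hbc : X.Triangle w b c) (hac : X.Triangle w a c) :
    X.Triangle a b c :=
  let ⟨s, hs, _, h⟩ := H.tetrahedron hab hbc hac; ⟨s, hs, h⟩

/-- Degenerate cycles are admitted, so that later arguments need not check distinctness. If the
cycle meets `w` or repeats a vertex, a diagonal, possibly of length zero, is immediate. -/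
theorem LocallyLarge.diagonal (H : X.LocallyLarge) {m : ℕ} (h4 : 4 ≤ m) (h7 : m < 7) {w : V}
    {c : ZMod m → V} (hc : ∀ i, X.Triangle w (c i) (c (i + 1))) :
    ∃ i j, i ≠ j ∧ j ≠ i + 1 ∧ i ≠ j + 1 ∧ X.Triangle w (c i) (c j) := by
  have hwX := (hc 0).edge.left
  have hgap : ∀ i : ZMod m, i ≠ i + 2 ∧ i + 2 ≠ i + 1 ∧ i ≠ i + 2 + 1 := by
    interval_cases m <;> decide
  by_cases hw : ∃ i, c i = w
  · obtain ⟨i, hi⟩ := hw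
    refine ⟨i, i + 2, (hgap i).1, (hgap i).2.1, (hgap i).2.2, ?_⟩
    rw [hi]
    exact (hc (i + 2)).edge.symm.triangle.swap.flip.swap
  by_cases hinj : Function.Injective c
  · push Not at hw
    have h01 : ∀ i : ZMod m, i ≠ i + 1 := by interval_cases m <;> decide
    obtain ⟨i, j, h1, h2, h3⟩ := (H w hwX).2 m h4 h7 c hinj (fun i =>
      ⟨fun h => h01 i (hinj h), link_edge_iff.mpr ⟨hw _, hw _, hc i⟩⟩)
    exact ⟨i, j, fun h => h3.1 (by rw [h]), h1, h2, (link_edge_iff.mp h3.2).2.2⟩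
  · simp only [Function.Injective, not_forall] at hinj
    obtain ⟨i, j, hij, hne⟩ := hinj
    have aux : ∀ i : ZMod m, c i = c (i + 1) →
        ∃ i j, i ≠ j ∧ j ≠ i + 1 ∧ i ≠ j + 1 ∧ X.Triangle w (c i) (c j) := by
      intro i hi
      refine ⟨i, i + 2, (hgap i).1, (hgap i).2.1, (hgap i).2.2, ?_⟩
      have := hc (i + 1)
      rwa [← hi, add_assoc, one_add_one_eq_two] at this
    by_cases h1 : j = i + 1
    · exact aux i (h1 ▸ hij)
    by_cases h2 : i = j + 1
    · exact aux j (h2 ▸ hij.symm)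
    · exact ⟨i, j, hne, h1, h2, hij ▸ (hc i).edge.triangle⟩

theorem LocallyLarge.square (H : X.LocallyLarge) {w a b c d : V} (h₁ : X.Triangle w a b)
    (h₂ : X.Triangle w b c) (h₃ : X.Triangle w c d) (h₄ : X.Triangle w d a) :
    X.Triangle w a c ∨ X.Triangle w b d := by
  obtain ⟨i, j, h, h', h'', ht⟩ := H.diagonal (m := 4) (by norm_num) (by norm_num) (w := w)
    (c := (![a, b, c, d] : Fin 4 → V)) (by
      intro i
      fin_cases i
      · exact h₁
      · exact h₂
      · exact h₃
      · exact h₄)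
  fin_cases i <;> fin_cases j <;> first
    | exact absurd rfl h
    | exact absurd rfl h'
    | exact absurd rfl h''
    | exact Or.inl ht
    | exact Or.inl ht.flip
    | exact Or.inr ht
    | exact Or.inr ht.flip

theorem LocallyLarge.pentagon (H : X.LocallyLarge) {w a b c d e : V} (h₁ : X.Triangle w a b)
    (h₂ : X.Triangle w b c) (h₃ : X.Triangle w c d) (h₄ : X.Triangle w d e)
    (h₅ : X.Triangle w e a) :
    X.Triangle w a c ∨ X.Triangle w b d ∨ X.Triangle w c e ∨ X.Triangle w d a ∨
      X.Triangle w e b := by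
  obtain ⟨i, j, h, h', h'', ht⟩ := H.diagonal (m := 5) (by norm_num) (by norm_num) (w := w)
    (c := (![a, b, c, d, e] : Fin 5 → V)) (by
      intro i
      fin_cases i
      · exact h₁
      · exact h₂
      · exact h₃
      · exact h₄
      · exact h₅)
  have ht' := ht.flip
  fin_cases i <;> fin_cases j <;> first
    | exact absurd rfl h
    | exact absurd rfl h'
    | exact absurd rfl h''
    | exact Or.inl ht
    | exact Or.inl ht'
    | exact Or.inr (Or.inl ht)
    | exact Or.inr (Or.inl ht')
    | exact Or.inr (Or.inr (Or.inl ht))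
    | exact Or.inr (Or.inr (Or.inl ht'))
    | exact Or.inr (Or.inr (Or.inr (Or.inl ht)))
    | exact Or.inr (Or.inr (Or.inr (Or.inl ht')))
    | exact Or.inr (Or.inr (Or.inr (Or.inr ht)))
    | exact Or.inr (Or.inr (Or.inr (Or.inr ht')))

theorem LocallyLarge.hexagon (H : X.LocallyLarge) {w a b c d e f : V} (h₁ : X.Triangle w a b)
    (h₂ : X.Triangle w b c) (h₃ : X.Triangle w c d) (h₄ : X.Triangle w d e)
    (h₅ : X.Triangle w e f) (h₆ : X.Triangle w f a) :
    (X.Triangle w a c ∨ X.Triangle w b d ∨ X.Triangle w c e ∨ X.Triangle w d f ∨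
      X.Triangle w e a ∨ X.Triangle w f b) ∨
      X.Triangle w a d ∨ X.Triangle w b e ∨ X.Triangle w c f := by
  obtain ⟨i, j, h, h', h'', ht⟩ := H.diagonal (m := 6) (by norm_num) (by norm_num) (w := w)
    (c := (![a, b, c, d, e, f] : Fin 6 → V)) (by
      intro i
      fin_cases i
      · exact h₁
      · exact h₂
      · exact h₃
      · exact h₄
      · exact h₅
      · exact h₆)
  have ht' := ht.flip
  fin_cases i <;> fin_cases j <;> first
    | exact absurd rfl h
    | exact absurd rfl h'
    | exact absurd rfl h''
    | exact Or.inl (Or.inl ht)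
    | exact Or.inl (Or.inl ht')
    | exact Or.inl (Or.inr (Or.inl ht))
    | exact Or.inl (Or.inr (Or.inl ht'))
    | exact Or.inl (Or.inr (Or.inr (Or.inl ht)))
    | exact Or.inl (Or.inr (Or.inr (Or.inl ht')))
    | exact Or.inl (Or.inr (Or.inr (Or.inr (Or.inl ht))))
    | exact Or.inl (Or.inr (Or.inr (Or.inr (Or.inl ht'))))
    | exact Or.inl (Or.inr (Or.inr (Or.inr (Or.inr (Or.inl ht)))))
    | exact Or.inl (Or.inr (Or.inr (Or.inr (Or.inr (Or.inl ht')))))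
    | exact Or.inl (Or.inr (Or.inr (Or.inr (Or.inr (Or.inr ht)))))
    | exact Or.inl (Or.inr (Or.inr (Or.inr (Or.inr (Or.inr ht')))))
    | exact Or.inr (Or.inl ht)
    | exact Or.inr (Or.inl ht')
    | exact Or.inr (Or.inr (Or.inl ht))
    | exact Or.inr (Or.inr (Or.inl ht'))
    | exact Or.inr (Or.inr (Or.inr ht))
    | exact Or.inr (Or.inr (Or.inr ht'))

end PreAbstractSimplicialComplex

/-! ### Developing the complex sphere by sphere -/

namespace PreAbstractSimplicialComplex

universe u

variable {V : Type u}

/-- The data of a sphere in the development of a complex: a set of vertices over `V`, the images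
of the neighbours of each vertex on the preceding sphere, and adjacency within the sphere. -/
structure Level (V : Type u) where
  S : Type u
  f : S → V
  low : S → Set V
  adj : S → S → Prop

namespace Level

variable (X : PreAbstractSimplicialComplex V) (L : Level V)

/-- `x` is the image of a neighbour of `w` on the next sphere. -/
def Valid (w : L.S) (x : V) : Prop :=
  X.Edge (L.f w) x ∧ x ≠ L.f w ∧ x ∉ L.low w ∧ ∀ a ∈ L.low w, ¬X.Triangle (L.f w) x a

/-- The vertices having in common with `w` the neighbour over `x` on the next sphere. -/
def near (w : L.S) (x : V) : Set L.S :=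
  {w' | L.Valid X w' x ∧ (w' = w ∨ L.adj w' w ∧ X.Triangle (L.f w') (L.f w) x)}

/-- The next sphere: its vertices are given by their image and their neighbours on this sphere. -/
def next : Level V where
  S := {z : V × Set L.S // ∃ w, L.Valid X w z.1 ∧ z.2 = L.near X w z.1}
  f z := z.1.1
  low z := L.f '' z.1.2
  adj z z' := z.1.1 ≠ z'.1.1 ∧ ∃ w ∈ z.1.2, w ∈ z'.1.2 ∧ X.Triangle (L.f w) z.1.1 z'.1.1

/-- The neighbours of `z` on the preceding sphere. -/
def rho (z : (L.next X).S) : Set L.S := z.1.2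

/-- The relations between the data of a sphere that make the construction of the next one work. -/
structure Good : Prop where
  vert : ∀ w, {L.f w} ∈ X.faces
  low_ne : ∀ {w a}, a ∈ L.low w → a ≠ L.f w
  clique_low : ∀ {w a b}, a ∈ L.low w → b ∈ L.low w → X.Triangle (L.f w) a b
  adj_symm : ∀ {w w'}, L.adj w w' → L.adj w' w
  adj_ne : ∀ {w w'}, L.adj w w' → L.f w ≠ L.f w'
  adj_edge : ∀ {w w'}, L.adj w w' → X.Edge (L.f w) (L.f w')
  common_low : ∀ {w w'}, L.adj w w' → ∃ a, a ∈ L.low w ∧ a ∈ L.low w'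
  exists_adj : ∀ {w a y}, a ∈ L.low w → X.Triangle (L.f w) a y → y ∉ L.low w → y ≠ L.f w →
    ∃ w', L.adj w w' ∧ L.f w' = y
  inj : ∀ {w w' w''}, L.adj w w' → L.adj w w'' → L.f w' = L.f w'' → w' = w''
  notMem_low : ∀ {w w'}, L.adj w w' → L.f w' ∉ L.low w
  adj_triangle : ∀ {w w' w''}, L.adj w w' → L.adj w w'' → L.adj w' w'' →
    X.Triangle (L.f w) (L.f w') (L.f w'')
  triangle_adj : ∀ {w w' w''}, L.adj w w' → L.adj w w'' → w' ≠ w'' →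
    X.Triangle (L.f w) (L.f w') (L.f w'') → L.adj w' w''
  low_triangle : ∀ {w w' a}, L.adj w w' → a ∈ L.low w → a ∈ L.low w' →
    X.Triangle (L.f w) (L.f w') a
  triangle_low : ∀ {w w' a}, L.adj w w' → a ∈ L.low w → X.Triangle (L.f w) (L.f w') a →
    a ∈ L.low w'

variable {X L}

theorem Good.not_triangle_of_valid (G : L.Good X) {w w' : L.S} {x : V} (hv : L.Valid X w x)
    (h : L.adj w w') : x ≠ L.f w' := by
  rintro rfl
  obtain ⟨a, ha, ha'⟩ := G.common_low h
  exact hv.2.2.2 a ha (G.low_triangle h ha ha')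

/-- Were `x` not new as seen from `w'`, it would be lower for `w'`, or the image of a neighbour of
`w'` on the same sphere. Either way it would already be lower or horizontal for `w`. -/
theorem Good.valid_of_adj (G : L.Good X) {w w' : L.S} {x : V} (hv : L.Valid X w x)
    (h : L.adj w w') (ht : X.Triangle (L.f w) (L.f w') x) : L.Valid X w' x := by
  have hx : x ∉ L.low w' := fun hx =>
    hv.2.2.1 (G.triangle_low (G.adj_symm h) hx ht.swap)
  refine ⟨ht.swap.edge', G.not_triangle_of_valid hv h, hx, fun a ha hta => ?_⟩
  obtain ⟨u, hu, rfl⟩ := G.exists_adj ha hta.flip hx (G.not_triangle_of_valid hv h)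
  have hwu : L.adj w u := by
    refine G.triangle_adj (G.adj_symm h) hu ?_ ht.swap
    rintro rfl
    exact hv.2.1 rfl
  exact G.not_triangle_of_valid hv hwu rfl

theorem Good.near_pair (H : X.LocallyLarge) (G : L.Good X) {w w₁ w₂ : L.S} {x : V}
    (hv : L.Valid X w x) (h₁ : w₁ ∈ L.near X w x) (h₂ : w₂ ∈ L.near X w x) :
    w₁ = w₂ ∨ L.adj w₁ w₂ ∧ X.Triangle (L.f w₁) (L.f w₂) x := by
  obtain ⟨hv₁, rfl | ⟨h₁, t₁⟩⟩ := h₁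
  · obtain ⟨hv₂, rfl | ⟨h₂, t₂⟩⟩ := h₂
    · exact Or.inl rfl
    · exact Or.inr ⟨G.adj_symm h₂, t₂.swap⟩
  obtain ⟨hv₂, rfl | ⟨h₂, t₂⟩⟩ := h₂
  · exact Or.inr ⟨h₁, t₁⟩
  by_cases hne : w₁ = w₂
  · exact Or.inl hne
  right
  have a₁ := G.adj_symm h₁
  have a₂ := G.adj_symm h₂
  -- With lower vertices `a`, `b` shared with `w₁`, `w₂`, the link of `w` contains the pentagon `x,
  -- w₁, a, b, w₂`. Validity of `x` forbids diagonals from `x` to `a` or `b`; the others give `w₁w₂`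
  -- at once or after one square.
  have key : X.Triangle (L.f w) (L.f w₁) (L.f w₂) := by
    obtain ⟨a, ha, ha₁⟩ := G.common_low a₁
    obtain ⟨b, hb, hb₂⟩ := G.common_low a₂
    have e1 := t₁.swap.flip
    have e2 := G.low_triangle a₁ ha ha₁
    have e3 := G.clique_low ha hb
    have e4 := (G.low_triangle a₂ hb hb₂).flip
    have e5 := t₂.swap
    rcases H.pentagon e1 e2 e3 e4 e5 with h | h | h | h | h
    · exact absurd h (hv.2.2.2 a ha)
    · rcases H.square e1 h e4 e5 with h | h
      · exact absurd h (hv.2.2.2 b hb)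
      · exact h
    · rcases H.square e1 e2 h e5 with h | h
      · exact absurd h (hv.2.2.2 a ha)
      · exact h
    · exact absurd h.flip (hv.2.2.2 b hb)
    · exact h.flip
  exact ⟨G.triangle_adj a₁ a₂ hne key,
    (H.triangle_of_tetrahedron key t₂.swap t₁.swap)⟩

/-- This identifies new vertices consistently: the pair of `x` and its set of lower neighbours is
the same from whichever of these neighbours it is built. -/
theorem Good.near_eq (H : X.LocallyLarge) (G : L.Good X) {w w' : L.S} {x : V}
    (hv : L.Valid X w x) (h : w' ∈ L.near X w x) : L.near X w' x = L.near X w x := by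
  have hw : w ∈ L.near X w' x := by
    refine ⟨hv, ?_⟩
    rcases h.2 with rfl | ⟨h, t⟩
    · exact Or.inl rfl
    · exact Or.inr ⟨G.adj_symm h, t.swap⟩
  ext u
  constructor
  · intro hu
    exact ⟨hu.1, G.near_pair H h.1 hu hw⟩
  · intro hu
    exact ⟨hu.1, G.near_pair H hv hu h⟩

theorem rho_nonempty (z : (L.next X).S) : (L.rho X z).Nonempty := by
  obtain ⟨w, hw, h⟩ := z.2
  exact ⟨w, by rw [rho, h]; exact ⟨hw, Or.inl rfl⟩⟩

theorem valid_of_mem_rho {z : (L.next X).S} {w : L.S} (h : w ∈ L.rho X z) :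
    L.Valid X w ((L.next X).f z) := by
  obtain ⟨w', hw', h'⟩ := z.2
  rw [rho, h'] at h
  exact h.1

theorem exists_of_valid {w : L.S} {x : V} (h : L.Valid X w x) :
    ∃ z : (L.next X).S, (L.next X).f z = x ∧ w ∈ L.rho X z :=
  ⟨⟨(x, L.near X w x), w, h, rfl⟩, rfl, h, Or.inl rfl⟩

theorem Good.rho_pair (H : X.LocallyLarge) (G : L.Good X) {z : (L.next X).S} {w w' : L.S}
    (h : w ∈ L.rho X z) (h' : w' ∈ L.rho X z) :
    w = w' ∨ L.adj w w' ∧ X.Triangle (L.f w) (L.f w') ((L.next X).f z) := by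
  obtain ⟨w₀, hw, hz⟩ := z.2
  rw [rho, hz] at h h'
  exact G.near_pair H hw h h'

theorem Good.rho_eq (H : X.LocallyLarge) (G : L.Good X) {z : (L.next X).S} {w : L.S}
    (h : w ∈ L.rho X z) : L.rho X z = L.near X w ((L.next X).f z) := by
  obtain ⟨w₀, hw, hz⟩ := z.2
  rw [rho, hz] at h ⊢
  exact (G.near_eq H hw h).symm

theorem Good.mem_rho (H : X.LocallyLarge) (G : L.Good X) {z : (L.next X).S} {w w' : L.S}
    (h : w ∈ L.rho X z) (hadj : L.adj w w')
    (ht : X.Triangle (L.f w) (L.f w') ((L.next X).f z)) : w' ∈ L.rho X z := by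
  rw [G.rho_eq H h]
  exact ⟨G.valid_of_adj (valid_of_mem_rho h) hadj ht, Or.inr ⟨G.adj_symm hadj, ht.swap⟩⟩

theorem Good.eq_of_mem_rho (H : X.LocallyLarge) (G : L.Good X) {z u : (L.next X).S} {w : L.S}
    (hz : w ∈ L.rho X z) (hu : w ∈ L.rho X u) (h : (L.next X).f z = (L.next X).f u) : z = u := by
  refine Subtype.ext (Prod.ext h ?_)
  exact (G.rho_eq H hz).trans (h ▸ (G.rho_eq H hu).symm)

theorem Good.triangle_of_mem_rho (H : X.LocallyLarge) (G : L.Good X) {z u : (L.next X).S}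
    {w : L.S} (h : (L.next X).adj z u) (hz : w ∈ L.rho X z) (hu : w ∈ L.rho X u) :
    X.Triangle ((L.next X).f z) ((L.next X).f u) (L.f w) := by
  obtain ⟨-, w', hz', hu', ht⟩ := h
  rcases G.rho_pair H hz hz' with rfl | ⟨-, t₁⟩
  · exact ht.swap.flip
  rcases G.rho_pair H hu hu' with rfl | ⟨-, t₂⟩
  · exact ht.swap.flip
  exact (H.triangle_of_tetrahedron t₁.swap ht t₂.swap).swap.flip

theorem Good.mem_rho_of_triangle (H : X.LocallyLarge) (G : L.Good X) {z u : (L.next X).S}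
    {w : L.S} (h : (L.next X).adj z u) (hz : w ∈ L.rho X z)
    (ht : X.Triangle ((L.next X).f z) ((L.next X).f u) (L.f w)) : w ∈ L.rho X u := by
  obtain ⟨-, w', hz', hu', ht'⟩ := h
  rcases G.rho_pair H hz hz' with rfl | ⟨ha, t⟩
  · exact hu'
  refine G.mem_rho H hu' (G.adj_symm ha) ?_
  exact H.triangle_of_tetrahedron t.flip.swap.flip ht.flip ht'.swap

theorem Good.eq_of_f_eq (H : X.LocallyLarge) (G : L.Good X) {z u : (L.next X).S}
    {w w' : L.S} (h : (L.next X).adj z u) (hz : w ∈ L.rho X z) (hu : w' ∈ L.rho X u)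
    (hf : L.f w = L.f w') : w = w' := by
  obtain ⟨-, w₀, hz₀, hu₀, -⟩ := h
  rcases G.rho_pair H hz₀ hz with rfl | ⟨h₁, -⟩
  · rcases G.rho_pair H hu₀ hu with rfl | ⟨h₂, -⟩
    · rfl
    · exact absurd hf (G.adj_ne h₂)
  · rcases G.rho_pair H hu₀ hu with rfl | ⟨h₂, -⟩
    · exact absurd hf.symm (G.adj_ne h₁)
    · exact G.inj h₁ h₂ hf

theorem Good.common_of_triangle (H : X.LocallyLarge) (G : L.Good X) {z u₁ u₂ : (L.next X).S}
    (h₁ : (L.next X).adj z u₁) (h₂ : (L.next X).adj z u₂)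
    (ht : X.Triangle ((L.next X).f z) ((L.next X).f u₁) ((L.next X).f u₂)) :
    ∃ w ∈ L.rho X z, w ∈ L.rho X u₁ ∧ w ∈ L.rho X u₂ := by
  obtain ⟨-, w₁, hz₁, hu₁, t₁⟩ := id h₁
  obtain ⟨-, w₂, hz₂, hu₂, t₂⟩ := id h₂
  rcases G.rho_pair H hz₁ hz₂ with rfl | ⟨-, t⟩
  · exact ⟨w₁, hz₁, hu₁, hu₂⟩
  -- The square `u₁, w₁, w₂, u₂` in the link of `z`; either diagonal makes one `wᵢ` common to all
  -- three.
  rcases H.square t₁.swap.flip t.flip.swap t₂.swap ht.flip with h | h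
  · exact ⟨w₂, hz₂, G.mem_rho_of_triangle H h₁ hz₂ h, hu₂⟩
  · exact ⟨w₁, hz₁, hu₁, G.mem_rho_of_triangle H h₂ hz₁ h.flip⟩

/-- Each edge of the new sphere has its own witness below. One witness for all three edges reduces
questions about triangles to the link of a single vertex. -/
theorem Good.common_of_adj (H : X.LocallyLarge) (G : L.Good X) {z u₁ u₂ : (L.next X).S}
    (h₁ : (L.next X).adj z u₁) (h₂ : (L.next X).adj z u₂) (h₃ : (L.next X).adj u₁ u₂) :
    ∃ w ∈ L.rho X z, w ∈ L.rho X u₁ ∧ w ∈ L.rho X u₂ := by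
  obtain ⟨-, w₁, hz₁, hu₁, t₁⟩ := h₁
  obtain ⟨-, w₂, hz₂, hu₂, -⟩ := h₂
  obtain ⟨-, w₃, hu₁', hu₂', -⟩ := h₃
  rcases G.rho_pair H hz₁ hz₂ with rfl | ⟨a₁₂, t₁₂⟩
  · exact ⟨w₁, hz₁, hu₁, hu₂⟩
  rcases G.rho_pair H hu₁ hu₁' with rfl | ⟨a₁₃, t₁₃⟩
  · exact ⟨w₁, hz₁, hu₁, hu₂'⟩
  rcases G.rho_pair H hu₂ hu₂' with rfl | ⟨a₂₃, -⟩
  · exact ⟨w₂, hz₂, hu₁', hu₂⟩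
  have t₁₂₃ := G.adj_triangle a₁₂ a₁₃ a₂₃
  -- The square `z, u₁, w₃, w₂` in the link of `w₁`.
  rcases H.square t₁ t₁₃.flip t₁₂₃.flip t₁₂ with h | h
  · exact ⟨w₃, G.mem_rho H hz₁ a₁₃ h.flip, hu₁', hu₂'⟩
  · exact ⟨w₂, hz₂, G.mem_rho H hu₁ a₁₂ h.flip, hu₂⟩

theorem edge_of_mem_rho {z : (L.next X).S} {w : L.S} (h : w ∈ L.rho X z) :
    X.Edge (L.f w) ((L.next X).f z) := (valid_of_mem_rho h).1

theorem Good.next_adj_symm {z u : (L.next X).S} (h : (L.next X).adj z u) :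
    (L.next X).adj u z :=
  let ⟨h, w, hz, hu, ht⟩ := h
  ⟨h.symm, w, hu, hz, ht.flip⟩

theorem Good.next (H : X.LocallyLarge) (G : L.Good X) : (L.next X).Good X where
  vert z := by
    obtain ⟨w, hw⟩ := rho_nonempty z
    exact (edge_of_mem_rho hw).right
  low_ne := by
    rintro z _ ⟨w, hw, rfl⟩
    exact (valid_of_mem_rho hw).2.1.symm
  clique_low := by
    rintro z _ _ ⟨w, hw, rfl⟩ ⟨w', hw', rfl⟩
    rcases G.rho_pair H hw hw' with rfl | ⟨-, t⟩
    · exact (edge_of_mem_rho hw).symm.triangle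
    · exact t.flip.swap
  adj_symm := Good.next_adj_symm
  adj_ne h := h.1
  adj_edge := by
    rintro z u ⟨-, w, -, -, ht⟩
    exact ht.swap.edge'
  common_low := by
    rintro z u ⟨-, w, hz, hu, -⟩
    exact ⟨L.f w, ⟨w, hz, rfl⟩, w, hu, rfl⟩
  exists_adj := by
    rintro z _ y ⟨w, hw, rfl⟩ ht hy hyz
    have hv := valid_of_mem_rho hw
    have hyw : y ≠ L.f w := fun h => hy ⟨w, hw, h.symm⟩
    have hyl : y ∉ L.low w := fun h => hv.2.2.2 y h ht.swap
    by_cases hval : L.Valid X w y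
    · obtain ⟨u, rfl, hu⟩ := exists_of_valid hval
      exact ⟨u, ⟨hyz.symm, w, hw, hu, ht.swap⟩, rfl⟩
    -- If `y` is not new over `w`, it is the image of a horizontal neighbour of `w`, which then lies
    -- below `z` too, so `y` would be lower for `z`.
    · exfalso
      refine hval ⟨ht.swap.edge', hyw, hyl, fun a ha hta => ?_⟩
      obtain ⟨w', hw', rfl⟩ := G.exists_adj ha hta.flip hyl hyw
      exact hy ⟨w', G.mem_rho H hw hw' ht.swap.flip, rfl⟩
  inj := by
    intro z u₁ u₂ h₁ h₂ hf
    obtain ⟨-, w', -, -, ht⟩ := id h₁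
    obtain ⟨w, hz, hu₁, hu₂⟩ := G.common_of_triangle H h₁ h₂ (by
      rw [← hf]; exact ht.swap.edge'.triangle)
    exact G.eq_of_mem_rho H hu₁ hu₂ hf
  notMem_low := by
    rintro z u ⟨-, w, hz, hu, ht⟩ ⟨w₂, hw₂, hf⟩
    have hv := valid_of_mem_rho hu
    rcases G.rho_pair H hz hw₂ with rfl | ⟨ha, -⟩
    · exact hv.2.1 hf.symm
    · exact G.not_triangle_of_valid hv ha hf.symm
  adj_triangle := by
    intro z u₁ u₂ h₁ h₂ h₃
    obtain ⟨w, hz, hu₁, hu₂⟩ := G.common_of_adj H h₁ h₂ h₃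
    exact H.triangle_of_tetrahedron (G.triangle_of_mem_rho H h₁ hz hu₁).flip.swap
      (G.triangle_of_mem_rho H h₃ hu₁ hu₂).flip.swap (G.triangle_of_mem_rho H h₂ hz hu₂).flip.swap
  triangle_adj := by
    intro z u₁ u₂ h₁ h₂ hne ht
    obtain ⟨w, hz, hu₁, hu₂⟩ := G.common_of_triangle H h₁ h₂ ht
    refine ⟨fun hf => hne (G.eq_of_mem_rho H hu₁ hu₂ hf), w, hu₁, hu₂, ?_⟩
    exact (H.triangle_of_tetrahedron (G.triangle_of_mem_rho H h₁ hz hu₁).flip ht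
      (G.triangle_of_mem_rho H h₂ hz hu₂).flip)
  low_triangle := by
    rintro z u _ h ⟨w, hw, rfl⟩ ⟨w', hw', hf⟩
    obtain rfl := G.eq_of_f_eq H h hw hw' hf.symm
    exact G.triangle_of_mem_rho H h hw hw'
  triangle_low := by
    rintro z u _ h ⟨w, hw, rfl⟩ ht
    exact ⟨w, G.mem_rho_of_triangle H h hw ht, rfl⟩

variable (X)

/-- The successive spheres of the development around `v`. -/
def iter (v : V) : ℕ → Level V
  | 0 => { S := PUnit, f := fun _ => v, low := fun _ => ∅, adj := fun _ _ => False }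
  | n + 1 => (iter v n).next X

variable {X}

theorem good_iter (H : X.LocallyLarge) {v : V} (hv : {v} ∈ X.faces) :
    ∀ n, (iter X v n).Good X
  | 0 => by constructor <;> simp [iter, hv]
  | n + 1 => (good_iter H hv n).next H

variable (X)

/-- The vertices of the development. -/
abbrev Dev (v : V) : Type u := Σ n, (iter X v n).S

/-- The vertex of `X` under a vertex of the development. -/
def Dev.proj (v : V) (y : Dev X v) : V := (iter X v y.1).f y.2

/-- Two vertices of the development are equal or adjacent. -/
inductive Dev.Rel (v : V) : Dev X v → Dev X v → Prop
  | refl (y) : Rel v y y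
  | hor {n} {w w' : (iter X v n).S} : (iter X v n).adj w w' → Rel v ⟨n, w⟩ ⟨n, w'⟩
  | up {n} {w : (iter X v n).S} {z : ((iter X v n).next X).S} :
      w ∈ (iter X v n).rho X z → Rel v ⟨n, w⟩ ⟨n + 1, z⟩
  | down {n} {w : (iter X v n).S} {z : ((iter X v n).next X).S} :
      w ∈ (iter X v n).rho X z → Rel v ⟨n + 1, z⟩ ⟨n, w⟩

end Level

end PreAbstractSimplicialComplex

/-! ### The development as a covering, and the level function it induces -/

namespace PreAbstractSimplicialComplex

universe u

variable {V : Type u} {X : PreAbstractSimplicialComplex V}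

namespace Level

/-- The other neighbours of the image of `w` are the lower ones, those spanning a triangle with `w`
and a lower one, and the rest. These lift down, horizontally and up respectively; `Valid` describes
exactly the third kind. -/
theorem Dev.isCovering (H : X.LocallyLarge) {v : V} (hv : {v} ∈ X.faces) :
    X.IsCovering (Dev.proj X v) (Dev.Rel X v) where
  refl := .refl
  symm h := by
    cases h with
    | refl => exact .refl _
    | hor h => exact .hor ((good_iter H hv _).adj_symm h)
    | up h => exact .down h
    | down h => exact .up h
  edge h := by
    cases h with
    | refl y => exact edge_self ((good_iter H hv _).vert _)
    | hor h => exact (good_iter H hv _).adj_edge h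
    | up h => exact edge_of_mem_rho h
    | down h => exact (edge_of_mem_rho h).symm
  eq h hf := by
    cases h with
    | refl => rfl
    | hor h => exact absurd hf ((good_iter H hv _).adj_ne h)
    | up h => exact absurd hf.symm (valid_of_mem_rho h).2.1
    | down h => exact absurd hf (valid_of_mem_rho h).2.1
  lift {y b} h := by
    obtain ⟨n, w⟩ := y
    have G := good_iter H hv n
    change X.Edge ((iter X v n).f w) b at h
    by_cases hb : b = (iter X v n).f w
    · exact ⟨⟨n, w⟩, .refl _, hb.symm⟩
    by_cases hl : b ∈ (iter X v n).low w
    · cases n with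
      | zero => exact absurd hl (Set.notMem_empty b)
      | succ n =>
        obtain ⟨w', hw', rfl⟩ := hl
        exact ⟨⟨n, w'⟩, .down hw', rfl⟩
    by_cases ht : ∃ a ∈ (iter X v n).low w, X.Triangle ((iter X v n).f w) b a
    · obtain ⟨a, ha, ht⟩ := ht
      obtain ⟨w', hw', rfl⟩ := G.exists_adj ha ht.flip hl hb
      exact ⟨⟨n, w'⟩, .hor hw', rfl⟩
    · push Not at ht
      obtain ⟨z, hz, hw⟩ := exists_of_valid (X := X) (L := iter X v n) ⟨h, hb, hl, ht⟩
      exact ⟨⟨n + 1, z⟩, .up hw, hz⟩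
  triangle {y y₁ y₂} h₁ h₂ ht := by
    cases h₁ with
    | refl => exact h₂
    | @hor n w w₁ h₁ =>
      cases h₂ with
      | refl => exact .hor ((good_iter H hv _).adj_symm h₁)
      | @hor _ _ w₂ h₂ =>
        by_cases hw : w₁ = w₂
        · rw [hw]; exact .refl _
        · exact .hor ((good_iter H hv _).triangle_adj h₁ h₂ hw ht)
      | up h₂ => exact .up ((good_iter H hv _).mem_rho H h₂ h₁ ht)
      | down h₂ => exact .down ((good_iter H hv _).mem_rho_of_triangle H h₁ h₂ ht)
    | @up n w z₁ h₁ =>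
      cases h₂ with
      | refl => exact .down h₁
      | hor h₂ => exact .down ((good_iter H hv _).mem_rho H h₁ h₂ ht.flip)
      | @up _ _ z₂ h₂ =>
        by_cases hz : ((iter X v n).next X).f z₁ = ((iter X v n).next X).f z₂
        · rw [(good_iter H hv _).eq_of_mem_rho H h₁ h₂ hz]; exact .refl _
        · exact .hor (n := n + 1) ⟨hz, w, h₁, h₂, ht⟩
      | down h₂ => exact absurd ht ((valid_of_mem_rho h₁).2.2.2 _ ⟨_, h₂, rfl⟩)
    | @down n w₁ z h₁ =>
      cases h₂ with
      | refl => exact .up h₁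
      | hor h₂ => exact .up ((good_iter H hv _).mem_rho_of_triangle H h₂ h₁ ht.flip)
      | up h₂ => exact absurd ht.flip ((valid_of_mem_rho h₂).2.2.2 _ ⟨_, h₁, rfl⟩)
      | down h₂ =>
        rcases (good_iter H hv _).rho_pair H h₁ h₂ with rfl | ⟨h, -⟩
        · exact .refl _
        · exact .hor h

/-- Pairwise adjacent vertices of the development, two of them on the same sphere, lie over a
face. -/
theorem Dev.triangle (H : X.LocallyLarge) {v : V} (hv : {v} ∈ X.faces) {y₁ y₂ y₃ : Dev X v}
    (h₁₂ : Rel X v y₁ y₂) (h₁₃ : Rel X v y₁ y₃) (h₂₃ : Rel X v y₂ y₃) (h : y₂.1 = y₃.1) :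
    X.Triangle (Dev.proj X v y₁) (Dev.proj X v y₂) (Dev.proj X v y₃) := by
  have C := Dev.isCovering H hv
  cases h₂₃ with
  | refl => exact (C.edge h₁₂).triangle
  | up => simp at h
  | down => simp at h
  | @hor n w w' h₂₃ =>
    cases h₁₂ with
    | refl => exact (C.edge h₁₃).symm.triangle.swap.flip.swap
    | hor h₁₂ =>
      cases h₁₃ with
      | refl => exact (C.edge (.hor h₁₂)).symm.triangle.swap
      | hor h₁₃ => exact (good_iter H hv _).adj_triangle h₁₂ h₁₃ h₂₃
    | up h₁₂ =>
      cases h₁₃ with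
      | up h₁₃ => exact ((good_iter H hv _).triangle_of_mem_rho H h₂₃ h₁₂ h₁₃).flip.swap
    | down h₁₂ =>
      cases h₁₃ with
      | down h₁₃ =>
        rcases (good_iter H hv _).rho_pair H h₁₂ h₁₃ with rfl | ⟨-, t⟩
        · exact (edge_of_mem_rho h₁₂).symm.triangle
        · exact t.flip.swap

theorem Dev.chain (v : V) (y : Dev X v) :
    Relation.ReflTransGen (Rel X v) ⟨0, PUnit.unit⟩ y := by
  obtain ⟨n, w⟩ := y
  induction n with
  | zero => exact .refl
  | succ n ih =>
    obtain ⟨w', hw'⟩ := rho_nonempty (X := X) (L := iter X v n) w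
    exact (ih w').tail (.up hw')

end Level

theorem IsCovering.eq_of_reflTransGen (hX : IsSimplyConnected X.space) {Y : Type*} {f : Y → V}
    {R : Y → Y → Prop} (C : X.IsCovering f R) {y y' : Y} (h : Relation.ReflTransGen R y y')
    (hf : f y = f y') : y = y' := by
  -- The chain is continued as a constant after its end, since `eq_of_closed` takes infinite edge
  -- paths.
  have : ∃ (m : ℕ) (e : ℕ → Y), e 0 = y ∧ (∀ k, m ≤ k → e k = y') ∧ ∀ k, R (e k) (e (k + 1)) := by
    clear hf
    induction h with
    | refl => exact ⟨0, fun _ => y, rfl, fun _ _ => rfl, fun _ => C.refl y⟩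
    | @tail b c _ hbc ih =>
      obtain ⟨m, e, h0, hm, hR⟩ := ih
      refine ⟨m + 1, fun k => if k ≤ m then e k else c, by simp [h0], fun k hk => ?_, fun k => ?_⟩
      · exact if_neg (by omega)
      · rcases lt_trichotomy k m with h | h | h
        · simpa [h.le, Nat.succ_le_of_lt h] using hR k
        · simpa [h, hm m le_rfl] using hbc
        · simpa [show ¬k ≤ m by omega, show ¬k + 1 ≤ m by omega] using C.refl c
  obtain ⟨m, e, h0, hm, hR⟩ := this
  have := C.eq_of_closed hX hR (m := m) (by rw [h0, hm m le_rfl, hf])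
  rwa [h0, hm m le_rfl] at this

/-- A level function on the vertices behaving like the distance from `v` in a systolic complex. -/
structure IsLevel (X : PreAbstractSimplicialComplex V) (v : V) (l : V → ℕ) : Prop where
  vert : {v} ∈ X.faces
  eq_zero : ∀ {a}, {a} ∈ X.faces → (l a = 0 ↔ a = v)
  edge_le : ∀ {a b}, X.Edge a b → l a ≤ l b + 1
  exists_lower : ∀ {a i}, {a} ∈ X.faces → l a = i + 1 → ∃ b, X.Edge a b ∧ l b = i
  edge_lower : ∀ {a b c i}, X.Edge a b → X.Edge a c → l a = i + 1 → l b = i → l c = i →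
    X.Edge b c
  common_lower : ∀ {a b i}, X.Edge a b → l a = i + 1 → l b = i + 1 →
    ∃ c, l c = i ∧ X.Edge a c ∧ X.Edge b c
  triangle : ∀ {a b c}, X.Edge a b → X.Edge b c → X.Edge a c → X.Triangle a b c

-- The development projects bijectively onto the vertices of `X`, and edges lift to the inverse
-- images of their endpoints. The level is the sphere number, and the properties of the development
-- carry over.
open Level in
theorem exists_isLevel (H : X.LocallyLarge) (hX : IsSimplyConnected X.space) {v : V}
    (hv : {v} ∈ X.faces) : ∃ l, X.IsLevel v l := by
  classical
  have C := Dev.isCovering H hv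
  have hinj : ∀ {y y' : Dev X v}, Dev.proj X v y = Dev.proj X v y' → y = y' := by
    intro y y' h
    refine C.eq_of_reflTransGen hX (Relation.ReflTransGen.trans ?_ (Dev.chain v y')) h
    have : Std.Symm (Dev.Rel X v) := ⟨fun _ _ => C.symm⟩
    exact Std.Symm.symm _ _ (Dev.chain v y)
  have hpt : ∀ a, {a} ∈ X.faces → ∃ x ∈ X.space, 0 < x a := by
    intro a ha
    refine ⟨Pi.single a 1, ⟨{a}, ha, fun u => ?_, fun u hu => ?_, by simp⟩, by simp⟩
    · by_cases h : u = a
      · subst h; simp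
      · simp [h]
    · simp at hu; simp [hu]
  have hsurj : ∀ a, {a} ∈ X.faces → ∃ y : Dev X v, Dev.proj X v y = a := by
    intro a ha
    have := reflTransGen_of_isPreconnected hX.isPathConnected.isConnected.isPreconnected
      subset_rfl (A := Set.univ) (by simp) (hpt v hv) (hpt a ha)
    induction this with
    | refl => exact ⟨⟨0, PUnit.unit⟩, rfl⟩
    | tail _ h ih =>
      obtain ⟨y, rfl⟩ := ih h.2.2.left
      obtain ⟨y', -, hy'⟩ := C.lift h.2.2
      exact ⟨y', hy'⟩
  have hex : ∀ a, ∃ y : Dev X v, {a} ∈ X.faces → Dev.proj X v y = a := by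
    intro a
    by_cases ha : {a} ∈ X.faces
    · obtain ⟨y, hy⟩ := hsurj a ha
      exact ⟨y, fun _ => hy⟩
    · exact ⟨⟨0, PUnit.unit⟩, fun h => absurd h ha⟩
  choose g hg using hex
  have hR : ∀ {a b}, X.Edge a b → Dev.Rel X v (g a) (g b) := by
    intro a b h
    have h' : X.Edge (Dev.proj X v (g a)) b := by rwa [hg a h.left]
    obtain ⟨y, hy, hyb⟩ := C.lift h'
    rwa [← hinj (hyb.trans (hg b h.right).symm)]
  have hgp : ∀ y : Dev X v, g (Dev.proj X v y) = y := fun y =>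
    hinj (hg _ ((good_iter H hv _).vert _))
  have htri : ∀ {a b c}, (g b).1 = (g c).1 → X.Edge a b → X.Edge a c → X.Edge b c →
      X.Triangle a b c := by
    intro a b c h hab hac hbc
    have := Dev.triangle H hv (hR hab) (hR hac) (hR hbc) h
    rwa [hg a hab.left, hg b hbc.left, hg c hbc.right] at this
  have hle : ∀ {a b}, X.Edge a b → (g a).1 ≤ (g b).1 + 1 := by
    intro a b h
    have := hR h
    generalize g a = y at *
    generalize g b = y' at *
    cases this with
    | refl => exact Nat.le_succ _
    | hor => exact Nat.le_succ _
    | up => exact (Nat.le_succ _).trans (Nat.le_succ _)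
    | down => exact le_rfl
  refine ⟨fun a => (g a).1, hv, fun {a} ha => ?_, hle, fun {a i} ha h => ?_,
    fun {a b c i} hab hac ha hb hc => ?_, fun {a b i} hab ha hb => ?_,
    fun {a b c} hab hbc hac => ?_⟩
  · constructor
    · intro h
      rw [← hg a ha]
      rcases hy : g a with ⟨n, w⟩
      rw [hy] at h
      obtain rfl : n = 0 := h
      rfl
    · rintro rfl
      have : g a = ⟨0, PUnit.unit⟩ := hgp ⟨0, PUnit.unit⟩
      rw [this]
  · rcases hy : g a with ⟨n, w⟩
    simp only [hy] at h
    subst h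
    obtain ⟨w', hw'⟩ := rho_nonempty (X := X) (L := iter X v i) w
    refine ⟨Dev.proj X v ⟨i, w'⟩, ?_, by rw [hgp]⟩
    have := C.edge (Dev.Rel.down hw')
    rwa [← hy, hg a ha] at this
  · have h1 := hR hab
    have h2 := hR hac
    rw [← hg b hab.right, ← hg c hac.right]
    apply C.edge
    generalize g a = y at *
    generalize g b = y₁ at *
    generalize g c = y₂ at *
    cases h1 with
    | refl => omega
    | hor => simp at *; omega
    | up => simp at *; omega
    | down h1 =>
      cases h2 with
      | refl => simp at *; omega
      | hor => simp at *; omega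
      | up => simp at *; omega
      | down h2 =>
        rcases (good_iter H hv _).rho_pair H h1 h2 with rfl | ⟨h, -⟩
        · exact .refl _
        · exact .hor h
  · have h1 := hR hab
    have ea := hg a hab.left
    have eb := hg b hab.right
    rw [← ea, ← eb]
    generalize g a = y at *
    generalize g b = y₁ at *
    have hlow : ∀ z : Dev X v, z.1 = i + 1 → ∃ c, (g c).1 = i ∧ X.Edge (Dev.proj X v z) c := by
      rintro ⟨n, w⟩ h
      obtain rfl : n = i + 1 := h
      obtain ⟨w', hw'⟩ := rho_nonempty (X := X) (L := iter X v i) w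
      exact ⟨Dev.proj X v ⟨i, w'⟩, by rw [hgp], C.edge (Dev.Rel.down hw')⟩
    cases h1 with
    | refl =>
      obtain ⟨c, hc, h⟩ := hlow _ ha
      exact ⟨c, hc, h, h⟩
    | @hor n w w' h1 =>
      obtain rfl : n = i + 1 := ha
      obtain ⟨-, w₀, h, h', -⟩ := h1
      exact ⟨Dev.proj X v ⟨i, w₀⟩, by rw [hgp], C.edge (Dev.Rel.down h), C.edge (Dev.Rel.down h')⟩
    | up => simp at *; omega
    | down => simp at *; omega
  · have h1 := hle hab
    have h2 := hle hab.symm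
    have h3 := hle hbc
    have h4 := hle hbc.symm
    have h5 := hle hac
    have h6 := hle hac.symm
    -- Levels of pairwise adjacent vertices differ by at most one, so two of the three agree.
    by_cases hbc' : (g b).1 = (g c).1
    · exact htri hbc' hab hac hbc
    by_cases hac' : (g a).1 = (g c).1
    · exact (htri hac' hab.symm hbc hac).swap
    · exact (htri (a := c) (b := a) (c := b) (by omega) hac.symm hbc.symm hab).swap.flip

end PreAbstractSimplicialComplex

/-! ### Spheres and geodesics in systolic chamber complexes -/

namespace PreAbstractSimplicialComplex

open Relation

universe u

variable {V : Type u} {X : PreAbstractSimplicialComplex V} {v : V} {l : V → ℕ} {n : ℕ}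

theorem IsLevel.face_of_pairwise (I : X.IsLevel v l) (H : X.LocallyLarge) {s : Finset V}
    (hs : s.Nonempty) (h : ∀ a ∈ s, ∀ b ∈ s, X.Edge a b) : s ∈ X.faces := by
  obtain ⟨w, hw⟩ := hs
  exact H.face_of_pairwise hw fun a ha b hb => I.triangle (h w hw a ha) (h a ha b hb) (h w hw b hb)

/-- The lower neighbours of one of two adjacent vertices of a sphere are neighbours of the other. -/
theorem IsLevel.nested (I : X.IsLevel v l) (H : X.LocallyLarge) {x y : V} {i : ℕ}
    (hxy : X.Edge x y) (hx : l x = i + 1) (hy : l y = i + 1) :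
    (∀ p, X.Edge x p → l p = i → X.Edge y p) ∨ ∀ q, X.Edge y q → l q = i → X.Edge x q := by
  by_contra! hcon
  obtain ⟨⟨p, hxp, hp, hyp⟩, q, hyq, hq, hxq⟩ := hcon
  obtain ⟨r, hr, hxr, hyr⟩ := I.common_lower hxy hx hy
  have hpr := I.edge_lower hxp hxr hx hp hr
  have hqr := I.edge_lower hyq hyr hy hq hr
  cases i with
  | zero =>
    exact hyp (((I.eq_zero hxp.right).mp hp).trans ((I.eq_zero hxr.right).mp hr).symm ▸ hyr)
  | succ j =>
    -- In the link of `r` this closes up the hexagon `p, x, y, q, b, a`. Each diagonal joins levels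
    -- two apart, gives a forbidden edge `yp`, `xq` or `pq`, or cuts off a pentagon that fails in
    -- the same way.
    obtain ⟨a, ha, hpa, hra⟩ := I.common_lower hpr hp hr
    obtain ⟨b, hb, hqb, hrb⟩ := I.common_lower hqr hq hr
    have hab := I.edge_lower hra hrb hr ha hb
    have far : ∀ {c d}, X.Edge c d → l c = j + 2 → l d = j → False := fun h hc hd => by
      have := I.edge_le h; omega
    have T : ∀ {c d}, X.Edge r c → X.Edge c d → X.Edge r d → X.Triangle r c d := I.triangle
    have t1 := T hpr.symm hxp.symm hxr.symm
    have t2 := T hxr.symm hxy hyr.symm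
    have t3 := T hyr.symm hyq hqr.symm
    have t4 := T hqr.symm hqb hrb
    have t5 := T hrb hab.symm hra
    have t6 := T hra hpa.symm hpr.symm
    have hpq : ¬X.Edge q p := fun h => by
      rcases H.square t1 t2 t3 (T hqr.symm h hpr.symm) with h | h
      · exact hyp h.swap.edge'.symm
      · exact hxq h.swap.edge'
    have e : ∀ {c d}, X.Triangle r c d → X.Edge c d := fun h => h.swap.edge'
    rcases H.hexagon t1 t2 t3 t4 t5 t6 with (h | h | h | h | h | h) | h | h | h
    · exact hyp (e h).symm
    · exact hxq (e h)
    · exact far (e h) hy hb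
    · rcases H.pentagon t1 t2 t3 h t6 with h | h | h | h | h
      · exact hyp (e h).symm
      · exact hxq (e h)
      · exact far (e h) hy ha
      · exact hpq (e h)
      · exact far (e h).symm hx ha
    · rcases H.pentagon t1 t2 t3 t4 h with h | h | h | h | h
      · exact hyp (e h).symm
      · exact hxq (e h)
      · exact far (e h) hy hb
      · exact hpq (e h)
      · exact far (e h).symm hx hb
    · exact far (e h).symm hx ha
    · exact hpq (e h).symm
    · exact far (e h) hx hb
    · exact far (e h) hy ha

/-- By nesting, `p` and `q` are lower neighbours of one and the same vertex, and those form a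
clique. -/
theorem IsLevel.edge_of_edge_succ (I : X.IsLevel v l) (H : X.LocallyLarge) {x y p q : V} {i : ℕ}
    (hxy : X.Edge x y) (hx : l x = i + 1) (hy : l y = i + 1) (hxp : X.Edge x p) (hp : l p = i)
    (hyq : X.Edge y q) (hq : l q = i) : X.Edge p q := by
  rcases I.nested H hxy hx hy with h | h
  · exact I.edge_lower (h p hxp hp) hyq hy hp hq
  · exact I.edge_lower hxp (h q hyq hq) hx hp hq

/-- Away from `p`, a chamber `t` has a further neighbour that is not adjacent to `p`. -/
theorem IsLevel.exists_opposite (I : X.IsLevel v l) (H : X.LocallyLarge)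
    (hX : X.IsChamberComplex n) (hn : 1 ≤ n) {t : Finset V} (ht : t ∈ X.faces)
    (htn : t.card = n + 1) {p : V} (hp : p ∈ t) :
    ∃ y, (∀ u ∈ t, u ≠ p → X.Edge u y) ∧ (∀ s ⊆ t, p ∉ s → ∃ s' ∈ X.faces, y ∈ s' ∧ s ⊆ s') ∧
      y ∉ t ∧ ¬X.Edge p y := by
  classical
  have hcard : (t.erase p).card = n := by rw [Finset.card_erase_of_mem hp, htn]; rfl
  have hne : (t.erase p).Nonempty := Finset.card_pos.mp (by omega)
  obtain ⟨t', ht', htt', ht'n, hsub⟩ :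
      ∃ t' ∈ X.faces, t' ≠ t ∧ t'.card = n + 1 ∧ t.erase p ⊆ t' := by
    obtain ⟨t₁, h₁, t₂, h₂, h12, hc₁, hc₂, hs₁, hs₂⟩ :=
      hX.2 _ (face_mono ht (Finset.erase_subset p t) hne) hcard
    by_cases h : t₁ = t
    · exact ⟨t₂, h₂, fun h' => h12 (h.trans h'.symm), hc₂, hs₂⟩
    · exact ⟨t₁, h₁, h, hc₁, hs₁⟩
  obtain ⟨y, hy, hyt⟩ := Finset.exists_mem_notMem_of_card_lt_card (s := t.erase p) (t := t')
    (by omega)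
  have hpt' : p ∉ t' := fun h => htt' (Finset.eq_of_subset_of_card_le (fun u hu => by
    by_cases hup : u = p
    · rwa [hup]
    · exact hsub (Finset.mem_erase.mpr ⟨hup, hu⟩)) (by omega)).symm
  have hyp : y ≠ p := fun h => hpt' (h ▸ hy)
  have hynt : y ∉ t := fun h => hyt (Finset.mem_erase.mpr ⟨hyp, h⟩)
  have hedge : ∀ u ∈ t, u ≠ p → X.Edge u y := fun u hu hup =>
    ⟨t', ht', hsub (Finset.mem_erase.mpr ⟨hup, hu⟩), hy⟩
  refine ⟨y, hedge, fun s hs hps =>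
    ⟨t', ht', hy, fun u hu => hsub (Finset.mem_erase.mpr ⟨fun h => hps (h ▸ hu), hs hu⟩)⟩,
    hynt, fun hpy => ?_⟩
  -- If `y` were adjacent to `p`, then `t` together with `y` would be a clique, hence a simplex of
  -- dimension exceeding `n`.
  have hall : ∀ u ∈ t, X.Edge u y := fun u hu => by
    by_cases hup : u = p
    · rwa [hup]
    · exact hedge u hu hup
  have hface : insert y t ∈ X.faces := by
    refine I.face_of_pairwise H (Finset.insert_nonempty y t) fun a ha b hb => ?_
    rw [Finset.mem_insert] at ha hb
    rcases ha with rfl | ha <;> rcases hb with rfl | hb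
    · exact edge_self hpy.right
    · exact (hall b hb).symm
    · exact hall a ha
    · exact ⟨t, ht, ha, hb⟩
  obtain ⟨T, hT, hTn, hsT⟩ := hX.1 _ hface
  have := Finset.card_le_card hsT
  rw [Finset.card_insert_of_notMem hynt] at this
  omega

/-- Adjacent vertices of a sphere have a common upper neighbour. -/
theorem IsLevel.common_upper (I : X.IsLevel v l) (H : X.LocallyLarge)
    (hX : X.IsChamberComplex n) (hn : 1 ≤ n) {w w' : V} {i : ℕ} (h : X.Edge w w')
    (hw : l w = i + 1) (hw' : l w' = i + 1) : ∃ x, l x = i + 2 ∧ X.Edge w x ∧ X.Edge w' x := by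
  classical
  by_contra! hcon
  let P : ℕ → Prop := fun k => ∃ σ ∈ X.faces, w ∈ σ ∧ w' ∈ σ ∧ (∀ u ∈ σ, l u = i + 1) ∧ σ.card = k
  have hcard : ∀ σ ∈ X.faces, σ.card ≤ n + 1 := fun σ hσ => by
    obtain ⟨t, -, htn, hst⟩ := hX.1 σ hσ
    exact htn ▸ Finset.card_le_card hst
  have hP : ∃ k ≤ n + 1, P k := by
    obtain ⟨s, hs, h1, h2⟩ := h
    have hsub : ({w, w'} : Finset V) ⊆ s := by
      intro u hu; simp at hu; rcases hu with rfl | rfl <;> assumption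
    have hf := face_mono hs hsub (by simp)
    exact ⟨_, hcard _ hf, _, hf, by simp, by simp, by simp [hw, hw'], rfl⟩
  obtain ⟨k, hk, hPk⟩ := hP
  -- `σ` is a largest simplex of the sphere containing `w` and `w'`.
  obtain ⟨σ, hσ, hwσ, hwσ', hlσ, hσk⟩ := Nat.findGreatest_spec hk hPk
  have hmax : ∀ τ ∈ X.faces, w ∈ τ → w' ∈ τ → (∀ u ∈ τ, l u = i + 1) → τ.card ≤ σ.card :=
    fun τ hτ h1 h2 h3 => by
      rw [hσk]
      exact Nat.le_findGreatest (hcard τ hτ) ⟨τ, hτ, h1, h2, h3, rfl⟩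
  -- By nesting, a lower neighbour of a vertex with the fewest (for inclusion) is adjacent to all of
  -- `σ`.
  obtain ⟨m, hm⟩ := Finset.exists_minimalFor (fun x => {p | X.Edge x p ∧ l p = i}) σ ⟨w, hwσ⟩
  have hmv : {m} ∈ X.faces := face_mono hσ (by simpa using hm.1) (by simp)
  obtain ⟨p, hmp, hp⟩ := I.exists_lower hmv (hlσ m hm.1)
  have hσp : ∀ y ∈ σ, X.Edge y p := by
    intro y hy
    rcases I.nested H ⟨σ, hσ, hm.1, hy⟩ (hlσ m hm.1) (hlσ y hy) with h | h
    · exact h p hmp hp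
    · exact (hm.2 hy (fun q hq => ⟨h q hq.1 hq.2, hq.2⟩) ⟨hmp, hp⟩).1
  have hpσ : p ∉ σ := fun h => by have := hlσ p h; omega
  have hface : insert p σ ∈ X.faces := by
    refine I.face_of_pairwise H (Finset.insert_nonempty p σ) fun a ha b hb => ?_
    rw [Finset.mem_insert] at ha hb
    rcases ha with rfl | ha <;> rcases hb with rfl | hb
    · exact edge_self hmp.right
    · exact (hσp b hb).symm
    · exact hσp a ha
    · exact ⟨σ, hσ, ha, hb⟩
  obtain ⟨t, ht, htn, hst⟩ := hX.1 _ hface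
  have hpt : p ∈ t := hst (Finset.mem_insert_self p σ)
  have hσt : σ ⊆ t := (Finset.subset_insert p σ).trans hst
  -- `y` is adjacent to all of `σ` but not to `p`. Level `i + 1` would enlarge `σ`, and level `i`
  -- would force an edge to `p`; only `i + 2` remains.
  obtain ⟨y, hy, hys, hyt, hpy⟩ := I.exists_opposite H hX hn ht htn hpt
  have hwp : ∀ u ∈ σ, u ≠ p := fun u hu h => hpσ (h ▸ hu)
  have hey : ∀ u ∈ σ, X.Edge u y := fun u hu => hy u (hσt hu) (hwp u hu)
  have hy2 : l y ≠ i + 2 := fun h => hcon y h (hey w hwσ) (hey w' hwσ')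
  have hy1 : l y ≠ i + 1 := by
    intro h
    obtain ⟨s', hs', hys', hss'⟩ := hys σ hσt hpσ
    have hle := hmax (insert y σ) (face_mono hs' (Finset.insert_subset hys' hss') (by simp))
      (Finset.mem_insert_of_mem hwσ) (Finset.mem_insert_of_mem hwσ') (by
        intro u hu
        rcases Finset.mem_insert.mp hu with rfl | hu
        · exact h
        · exact hlσ u hu)
    rw [Finset.card_insert_of_notMem fun h => hyt (hσt h)] at hle
    omega
  have hy0 : l y ≠ i := fun h =>
    hpy (I.edge_lower hmp (hey m hm.1) (hlσ m hm.1) hp h)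
  have := I.edge_le (hey w hwσ)
  have := I.edge_le (hey w hwσ).symm
  omega

theorem IsLevel.exists_upper (I : X.IsLevel v l) (H : X.LocallyLarge)
    (hX : X.IsChamberComplex n) (hn : 1 ≤ n) {u : V} {i : ℕ} (hu : {u} ∈ X.faces) (h : l u = i) :
    ∃ x, l x = i + 1 ∧ X.Edge u x := by
  cases i with
  | zero =>
    obtain ⟨t, ht, htn, hut⟩ := hX.1 _ hu
    obtain ⟨x, hx, hxu⟩ := Finset.exists_mem_ne (s := t) (by omega) u
    have he : X.Edge u x := ⟨t, ht, hut (by simp), hx⟩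
    refine ⟨x, ?_, he⟩
    have h1 := I.edge_le he.symm
    have h2 : l x ≠ 0 := fun h0 =>
      hxu (((I.eq_zero he.right).mp h0).trans ((I.eq_zero hu).mp h).symm)
    omega
  | succ i =>
    obtain ⟨x, hx, hux, -⟩ := I.common_upper H hX hn (edge_self hu) h h
    exact ⟨x, hx, hux⟩

/-! ### Connectedness of spheres -/

/-- Condition `R` in combinatorial form: the vertices of `Y` at distance at least `2` from `ρ` are
joined up by edges. -/
theorem reflTransGen_of_ballInterior {Y : PreAbstractSimplicialComplex V} {ρ : Finset V}
    (h : IsPreconnected (Y.space \ Y.ballInterior (simplex ρ) 2)) {a b : V}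
    (ha : {a} ∈ Y.faces) (haρ : ∀ c ∈ ρ, ¬Y.Edge a c)
    (hb : {b} ∈ Y.faces) (hbρ : ∀ c ∈ ρ, ¬Y.Edge b c) :
    ReflTransGen (fun u w => (∀ c ∈ ρ, ¬Y.Edge u c) ∧ (∀ c ∈ ρ, ¬Y.Edge w c) ∧ Y.Edge u w) a b := by
  classical
  have hball : ∀ {u}, {u} ∈ (Y.ball (simplex ρ) 1).faces ↔ ∃ c ∈ ρ, Y.Edge u c := by
    intro u
    constructor
    · rintro ⟨-, τ, hτ, huτ, c, hc, -, hcρ⟩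
      exact ⟨c, by simpa using hcρ, τ, hτ, by simpa using huτ, hc⟩
    · rintro ⟨c, hc, τ, hτ, hu, hcτ⟩
      exact ⟨by simp, τ, hτ, by simpa using hu, c, hcτ, by simp, by simpa using hc⟩
  have hpt : ∀ u, {u} ∈ Y.faces → (∀ c ∈ ρ, ¬Y.Edge u c) →
      ∃ x ∈ Y.space \ Y.ballInterior (simplex ρ) 2, 0 < x u := by
    intro u hu hρ
    have hnn : ∀ w, 0 ≤ (Pi.single u 1 : V → ℝ) w := fun w => by
      by_cases hw : w = u
      · subst hw; simp
      · simp [hw]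
    have h0 : ∀ w, w ∉ ({u} : Finset V) → (Pi.single u 1 : V → ℝ) w = 0 := fun w hw => by
      simp at hw; simp [hw]
    refine ⟨Pi.single u 1, ⟨⟨{u}, hu, hnn, h0, by simp⟩, ?_⟩, by simp⟩
    rintro ⟨⟨s, hs, -, hs0, -⟩, hns⟩
    have hus : u ∈ s := by
      by_contra hus
      have := hs0 u hus
      simp at this
    refine hns ⟨{u}, ⟨face_mono hs (by simpa using hus) (by simp), ?_⟩, hnn, h0, by simp⟩
    intro w hw
    rw [Finset.mem_singleton.mp hw]
    exact fun h => by
      obtain ⟨c, hc, hcu⟩ := hball.mp h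
      exact hρ c hc hcu
  refine reflTransGen_of_isPreconnected h Set.sdiff_subset (A := {u | ∀ c ∈ ρ, ¬Y.Edge u c})
    ?_ (hpt a ha haρ) (hpt b hb hbρ)
  -- A point with a support vertex in `B_1` has its carrier in `B_2` and is not in `S_2`, so it is
  -- interior to `B_2`.
  rintro x ⟨⟨s, hs, hnn, h0, h1⟩, hx⟩ u hu c hc huc
  have hball1 := hball.mpr ⟨c, hc, huc⟩
  refine hx ⟨⟨s, ⟨(Y.isRelLowerSet_faces hs).1, s, hs, subset_rfl, u, ?_, hball1⟩, hnn, h0, h1⟩, ?_⟩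
  · by_contra hus
    exact hu.ne' (h0 u hus)
  · rintro ⟨s', ⟨-, hs'⟩, -, h0', -⟩
    refine hs' u ?_ hball1
    by_contra hus
    exact hu.ne' (h0' u hus)

/-- Adjacency (or equality) within a sphere. -/
def SphereAdj (X : PreAbstractSimplicialComplex V) (l : V → ℕ) (i : ℕ) (x y : V) : Prop :=
  l x = i ∧ l y = i ∧ X.Edge x y

theorem finite_neighbors (hX : X.IsLocallyFinite) (w : V) : {u | X.Edge w u}.Finite := by
  refine ((hX w).biUnion fun s _ => s.finite_toSet).subset ?_
  rintro u ⟨s, hs, hw, hu⟩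
  exact Set.mem_biUnion (show s ∈ {s ∈ X.faces | w ∈ s} from ⟨hs, hw⟩) hu

/-- The upper neighbours of a vertex are connected within their sphere. -/
theorem IsLevel.upper_connected (I : X.IsLevel v l) (H : X.LocallyLarge) (hX : X.IsLocallyFinite)
    {w : V} (hR : X.ConditionR w) {i : ℕ} (hw : l w = i + 1) {x y : V} (hx : X.Edge w x)
    (hy : X.Edge w y) (hlx : l x = i + 2) (hly : l y = i + 2) :
    ReflTransGen (X.SphereAdj l (i + 2)) x y := by
  classical
  have hfin : {p | X.Edge w p ∧ l p = i}.Finite := (finite_neighbors hX w).subset fun p hp => hp.1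
  set ρ := hfin.toFinset with hρ
  have hmem : ∀ {p}, p ∈ ρ ↔ X.Edge w p ∧ l p = i := by simp [hρ]
  have hwρ : w ∉ ρ := fun h => by have := (hmem.mp h).2; omega
  have hρne : ρ.Nonempty := by
    obtain ⟨p, hp⟩ := I.exists_lower hx.left hw
    exact ⟨p, hmem.mpr hp⟩
  have hface : insert w ρ ∈ X.faces := by
    refine I.face_of_pairwise H (Finset.insert_nonempty w ρ) fun a ha b hb => ?_
    rw [Finset.mem_insert] at ha hb
    rcases ha with rfl | ha <;> rcases hb with rfl | hb
    · exact edge_self hx.left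
    · exact (hmem.mp hb).1
    · exact (hmem.mp ha).1.symm
    · exact I.edge_lower (hmem.mp ha).1 (hmem.mp hb).1 hw (hmem.mp ha).2 (hmem.mp hb).2
  have hlink : ρ ∈ (X.link {w}).faces :=
    ⟨hρne, by simpa using hwρ, insert w ρ, hface, by simp, Finset.subset_insert w ρ⟩
  have hup : ∀ {u}, X.Edge w u → l u = i + 2 →
      {u} ∈ (X.link {w}).faces ∧ ∀ c ∈ ρ, ¬(X.link {w}).Edge u c := by
    intro u hu hlu
    refine ⟨link_vertex_iff.mpr ⟨fun h => by subst h; omega, hu⟩, fun c hc h => ?_⟩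
    have h1 := I.edge_le (link_edge_iff.mp h).2.2.swap.edge'
    have h2 := (hmem.mp hc).2
    omega
  -- A link vertex on the sphere of `w` shares a lower neighbour with `w`, so it is adjacent to `ρ`.
  -- What lies away from `ρ` is exactly the upper part.
  have hlev : ∀ {u}, {u} ∈ (X.link {w}).faces → (∀ c ∈ ρ, ¬(X.link {w}).Edge u c) →
      l u = i + 2 := by
    intro u hu hρu
    obtain ⟨huw, hwu⟩ := link_vertex_iff.mp hu
    have h0 : l u ≠ i := fun h => hρu u (hmem.mpr ⟨hwu, h⟩) (edge_self hu)
    have h1 : l u ≠ i + 1 := fun h => by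
      obtain ⟨c, hc, hwc, huc⟩ := I.common_lower hwu hw h
      exact hρu c (hmem.mpr ⟨hwc, hc⟩) (link_edge_iff.mpr ⟨huw, fun h => by subst h; omega,
        I.triangle hwu huc hwc⟩)
    have := I.edge_le hwu
    have := I.edge_le hwu.symm
    omega
  obtain ⟨hx1, hx2⟩ := hup hx hlx
  obtain ⟨hy1, hy2⟩ := hup hy hly
  refine ReflTransGen.mono ?_ _ _
    (reflTransGen_of_ballInterior (hR ρ hlink).1.isPreconnected hx1 hx2 hy1 hy2)
  rintro a b ⟨ha, hb, hab⟩
  exact ⟨hlev hab.left ha, hlev hab.right hb, (link_edge_iff.mp hab).2.2.swap.edge'⟩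

theorem IsLevel.level_one_iff (I : X.IsLevel v l) {a : V} :
    ({a} ∈ X.faces ∧ l a = 1) ↔ a ≠ v ∧ X.Edge v a := by
  have hv : l v = 0 := (I.eq_zero I.vert).mpr rfl
  constructor
  · rintro ⟨ha, h⟩
    obtain ⟨b, hab, hb⟩ := I.exists_lower ha h
    obtain rfl := (I.eq_zero hab.right).mp hb
    exact ⟨fun h => by subst h; omega, hab.symm⟩
  · rintro ⟨ha, h⟩
    refine ⟨h.right, ?_⟩
    have h1 := I.edge_le h.symm
    have h2 := (I.eq_zero h.right).not.mpr ha
    omega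

/-- The vertex `v` has no lower neighbours, so condition `R` is applied with the simplex `{x}`: it
joins the link vertices not adjacent to `x`. Two steps, through a chamber and its opposite vertex,
lead from `x` to one of these. -/
theorem IsLevel.link_connected (I : X.IsLevel v l) (H : X.LocallyLarge)
    (hX : X.IsChamberComplex n) (hn : 2 ≤ n) (hR : X.ConditionR v) {x y : V}
    (hx : {x} ∈ X.faces) (hy : {y} ∈ X.faces) (hlx : l x = 1) (hly : l y = 1) :
    ReflTransGen (X.SphereAdj l 1) x y := by
  classical
  obtain ⟨hxv, hvx⟩ := I.level_one_iff.mp ⟨hx, hlx⟩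
  have hxl : {x} ∈ (X.link {v}).faces := link_vertex_iff.mpr ⟨hxv, hvx⟩
  have hlev : ∀ {u}, {u} ∈ (X.link {v}).faces → l u = 1 := fun h =>
    (I.level_one_iff.mpr (link_vertex_iff.mp h)).2
  have hfar : ∀ {a b}, a ≠ v → b ≠ v → X.Edge v a → X.Edge v b → ¬X.Edge x a → ¬X.Edge x b →
      ReflTransGen (X.SphereAdj l 1) a b := by
    intro a b ha hb hva hvb hxa hxb
    refine ReflTransGen.mono ?_ _ _ (reflTransGen_of_ballInterior (hR {x} hxl).1.isPreconnected
      (link_vertex_iff.mpr ⟨ha, hva⟩) ?_ (link_vertex_iff.mpr ⟨hb, hvb⟩) ?_)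
    · rintro a b ⟨-, -, hab⟩
      exact ⟨hlev hab.left, hlev hab.right, (link_edge_iff.mp hab).2.2.swap.edge'⟩
    · intro c hc h
      rw [Finset.mem_singleton.mp hc] at h
      exact hxa (link_edge_iff.mp h).2.2.swap.edge'.symm
    · intro c hc h
      rw [Finset.mem_singleton.mp hc] at h
      exact hxb (link_edge_iff.mp h).2.2.swap.edge'.symm
  have hnear : ∀ {b}, b ≠ v → b ≠ x → X.Edge v b → X.Edge x b →
      ∃ y, y ≠ v ∧ X.Edge v y ∧ X.Edge b y ∧ ¬X.Edge x y := by
    intro b hbv hbx hvb hxb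
    obtain ⟨s, hs, hvs, hxs, hbs⟩ := I.triangle hvx hxb hvb
    obtain ⟨t, ht, htn, hst⟩ := hX.1 s hs
    obtain ⟨y, hy, -, hyt, hxy⟩ := I.exists_opposite H hX (by omega) ht htn (hst hxs)
    exact ⟨y, fun h => hyt (h ▸ hst hvs), hy v (hst hvs) hxv.symm, hy b (hst hbs) hbx, hxy⟩
  have hone : ∀ {a b}, a ≠ v → b ≠ v → X.Edge v a → X.Edge v b → X.Edge a b →
      ReflTransGen (X.SphereAdj l 1) a b := fun ha hb hva hvb hab =>
    .single ⟨(I.level_one_iff.mpr ⟨ha, hva⟩).2, (I.level_one_iff.mpr ⟨hb, hvb⟩).2, hab⟩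
  obtain ⟨hyv, hvy⟩ := I.level_one_iff.mp ⟨hy, hly⟩
  by_cases hxy : X.Edge x y
  · exact hone hxv hyv hvx hvy hxy
  obtain ⟨b, hbv, hbx, hvb, hxb⟩ : ∃ b, b ≠ v ∧ b ≠ x ∧ X.Edge v b ∧ X.Edge x b := by
    obtain ⟨s, hs, hvs, hxs⟩ := hvx
    obtain ⟨t, ht, htn, hst⟩ := hX.1 s hs
    -- Since `n ≥ 2`, a chamber has a third vertex.
    obtain ⟨b, hb, hbn⟩ := Finset.exists_mem_notMem_of_card_lt_card (s := {v, x}) (t := t)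
      (by have := Finset.card_le_two (a := v) (b := x); omega)
    simp only [Finset.mem_insert, Finset.mem_singleton, not_or] at hbn
    exact ⟨b, hbn.1, hbn.2, ⟨t, ht, hst hvs, hb⟩, t, ht, hst hxs, hb⟩
  obtain ⟨z, hzv, hvz, hbz, hxz⟩ := hnear hbv hbx hvb hxb
  exact ((hone hxv hbv hvx hvb hxb).trans (hone hbv hzv hvb hvz hbz)).trans
    (hfar hzv hyv hvz hvy hxz hxy)

/-- Spheres of positive radius are connected. -/
theorem IsLevel.sphere_connected (I : X.IsLevel v l) (H : X.LocallyLarge)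
    (hX : X.IsChamberComplex n) (hn : 2 ≤ n) (hfin : X.IsLocallyFinite)
    (hR : ∀ w, {w} ∈ X.faces → X.ConditionR w) {i : ℕ} {x y : V} (hx : {x} ∈ X.faces)
    (hy : {y} ∈ X.faces) (hlx : l x = i + 1) (hly : l y = i + 1) :
    ReflTransGen (X.SphereAdj l (i + 1)) x y := by
  induction i generalizing x y with
  | zero => exact I.link_connected H hX hn (hR v I.vert) hx hy hlx hly
  | succ i ih =>
    obtain ⟨w, hxw, hw⟩ := I.exists_lower hx hlx
    obtain ⟨w', hyw', hw'⟩ := I.exists_lower hy hly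
    have hchain := ih hxw.right hyw'.right hw hw'
    clear hw'
    -- Along the path in the lower sphere, each edge receives a common upper neighbour `z`;
    -- successive ones lie above a common vertex and are joined by `upper_connected`.
    induction hchain generalizing y with
    | refl => exact I.upper_connected H hfin (hR w hxw.right) hw hxw.symm hyw'.symm hlx hly
    | @tail b c _ hbc hind =>
      obtain ⟨z, hz, hbz, hcz⟩ := I.common_upper H hX (by omega) hbc.2.2 hbc.1 hbc.2.1
      exact (hind hbz.right hz hbz.symm).trans
        (I.upper_connected H hfin (hR c hcz.left) hbc.2.1 hcz hyw'.symm hz hly)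

end PreAbstractSimplicialComplex

/-! ### Geodesic rays and the ideal boundary -/

namespace PreAbstractSimplicialComplex

open Relation

universe u

variable {V : Type u} {X : PreAbstractSimplicialComplex V} {v : V} {l : V → ℕ} {n : ℕ}

theorem Edge.eq_or_adj {a b : V} (h : X.Edge a b) : a = b ∨ X.graph.Adj a b :=
  (eq_or_ne a b).imp_right fun hab => ⟨hab, h⟩

theorem Edge.reachable {a b : V} (h : X.Edge a b) : X.graph.Reachable a b := by
  rcases h.eq_or_adj with rfl | h
  · rfl
  · exact h.reachable

theorem Edge.dist_le_one {a b : V} (h : X.Edge a b) : X.graph.dist a b ≤ 1 := by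
  rcases h.eq_or_adj with rfl | h
  · simp
  · exact (SimpleGraph.dist_eq_one_iff_adj.mpr h).le

theorem IsLevel.le_add_dist (I : X.IsLevel v l) {a b : V} (h : X.graph.Reachable a b) :
    l b ≤ l a + X.graph.dist a b := by
  obtain ⟨p, hp⟩ := h.exists_walk_length_eq_dist
  rw [← hp]
  clear hp h
  induction p with
  | nil => simp
  | cons h p ih =>
    have := I.edge_le (Edge.symm (X := X) h.2)
    rw [SimpleGraph.Walk.length_cons]
    omega

/-- Paths along which the level increases by one at each step. -/
def IsAscending (X : PreAbstractSimplicialComplex V) (l : V → ℕ) (c : ℕ → V) : Prop :=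
  ∀ k, l (c k) = k ∧ X.Edge (c k) (c (k + 1))

/-- Reachability is carried along because `SimpleGraph.dist` is `0` between unreachable vertices. -/
theorem IsLevel.reachable_and_dist (I : X.IsLevel v l) {a : V} (ha : {a} ∈ X.faces) :
    X.graph.Reachable v a ∧ X.graph.dist v a = l a := by
  have hv : l v = 0 := (I.eq_zero I.vert).mpr rfl
  induction h : l a generalizing a with
  | zero =>
    obtain rfl := (I.eq_zero ha).mp h
    simp
  | succ i ih =>
    obtain ⟨b, hab, hb⟩ := I.exists_lower ha h
    obtain ⟨hr, hd⟩ := ih hab.right hb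
    have hra := hr.trans hab.symm.reachable
    have h1 := I.le_add_dist hra
    have h2 := hr.dist_triangle_left (w := a)
    have h3 := hab.symm.dist_le_one
    exact ⟨hra, by omega⟩

theorem IsLevel.dist_of_isAscending (I : X.IsLevel v l) {c : ℕ → V} (hc : X.IsAscending l c) :
    c 0 = v ∧ ∀ i j, X.graph.dist (c i) (c (i + j)) = j := by
  refine ⟨(I.eq_zero (hc 0).2.left).mp (hc 0).1, fun i j => ?_⟩
  have key : X.graph.Reachable (c i) (c (i + j)) ∧ X.graph.dist (c i) (c (i + j)) ≤ j := by
    induction j with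
    | zero => simp
    | succ j ih =>
      have he := (hc (i + j)).2
      refine ⟨ih.1.trans he.reachable, ?_⟩
      have h1 := ih.1.dist_triangle_left (w := c (i + j + 1))
      have h2 := he.dist_le_one
      rw [← add_assoc]
      omega
  have h1 := I.le_add_dist key.1
  rw [(hc i).1, (hc (i + j)).1] at h1
  omega

theorem IsLevel.isAscending_of_dist (I : X.IsLevel v l) {c : ℕ → V} (h0 : c 0 = v)
    (hc : ∀ i j, X.graph.dist (c i) (c (i + j)) = j) : X.IsAscending l c := by
  have he : ∀ k, X.Edge (c k) (c (k + 1)) := fun k =>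
    (SimpleGraph.dist_eq_one_iff_adj.mp (hc k 1)).2
  refine fun k => ⟨?_, he k⟩
  have h := hc 0 k
  rw [zero_add, h0, (I.reachable_and_dist (he k).left).2] at h
  exact h

theorem IsLevel.exists_ascending_from (I : X.IsLevel v l) (H : X.LocallyLarge)
    (hX : X.IsChamberComplex n) (hn : 1 ≤ n) {z : V} (hz : {z} ∈ X.faces) :
    ∃ d : ℕ → V, d 0 = z ∧ ∀ k, l (d k) = l z + k ∧ X.Edge (d k) (d (k + 1)) := by
  classical
  have hex : ∀ u, ∃ x, {u} ∈ X.faces → l x = l u + 1 ∧ X.Edge u x := by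
    intro u
    by_cases hu : {u} ∈ X.faces
    · obtain ⟨x, hx⟩ := I.exists_upper H hX hn hu rfl
      exact ⟨x, fun _ => hx⟩
    · exact ⟨u, fun h => absurd h hu⟩
  choose up hup using hex
  have hvert : ∀ k, {up^[k] z} ∈ X.faces ∧ l (up^[k] z) = l z + k := by
    intro k
    induction k with
    | zero => exact ⟨hz, rfl⟩
    | succ k ih =>
      rw [Function.iterate_succ_apply']
      obtain ⟨h1, h2⟩ := hup _ ih.1
      exact ⟨h2.right, by rw [h1, ih.2]; rfl⟩
  refine ⟨fun k => up^[k] z, rfl, fun k => ⟨(hvert k).2, ?_⟩⟩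
  dsimp only
  rw [Function.iterate_succ_apply']
  exact (hup _ (hvert k).1).2

/-- Every vertex lies on an ascending path from `v`. -/
theorem IsLevel.exists_ascending (I : X.IsLevel v l) (H : X.LocallyLarge)
    (hX : X.IsChamberComplex n) (hn : 1 ≤ n) {z : V} (hz : {z} ∈ X.faces) {M : ℕ} (hM : l z = M) :
    ∃ c, X.IsAscending l c ∧ c M = z := by
  obtain ⟨d, hd0, hd⟩ := I.exists_ascending_from H hX hn hz
  cases M with
  | zero => exact ⟨d, fun k => by simpa [hM] using hd k, hd0⟩
  | succ M =>
    obtain ⟨w, hzw, hw⟩ := I.exists_lower hz hM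
    obtain ⟨c, hc, hcM⟩ := I.exists_ascending H hX hn hzw.right hw
    -- An ascending path is followed up to the lower neighbour of `z` at level `M`; the path
    -- starting at `z` takes over at `M + 1`.
    refine ⟨fun k => if k ≤ M then c k else d (k - (M + 1)), fun k => ?_, by simp [hd0]⟩
    dsimp only
    rcases lt_trichotomy k M with h | rfl | h
    · rw [if_pos h.le, if_pos (Nat.succ_le_of_lt h)]
      exact hc k
    · rw [if_pos le_rfl, if_neg (by omega), Nat.sub_self, hd0]
      exact ⟨(hc k).1, hcM ▸ hzw.symm⟩
    · rw [if_neg (by omega), if_neg (by omega), show k + 1 - (M + 1) = k - (M + 1) + 1 by omega,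
        (hd _).1]
      exact ⟨by omega, (hd _).2⟩

theorem IsLevel.edge_of_le (I : X.IsLevel v l) (H : X.LocallyLarge) {c d : ℕ → V}
    (hc : X.IsAscending l c) (hd : X.IsAscending l d) {k M : ℕ} (hkM : k ≤ M)
    (h : X.Edge (c M) (d M)) : X.Edge (c k) (d k) := by
  induction M, hkM using Nat.le_induction with
  | base => exact h
  | succ M _ ih =>
    exact ih (I.edge_of_edge_succ H h (hc _).1 (hd _).1 (hc M).2.symm (hc M).1 (hd M).2.symm
      (hd M).1)

/-! ### Compactness of the space of rays and connectedness of the boundary -/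

theorem IsLevel.finite_sphere (I : X.IsLevel v l) (hX : X.IsLocallyFinite) (k : ℕ) :
    {u | {u} ∈ X.faces ∧ l u = k}.Finite := by
  induction k with
  | zero =>
    refine (Set.finite_singleton v).subset ?_
    rintro u ⟨hu, h⟩
    exact (I.eq_zero hu).mp h
  | succ k ih =>
    refine (ih.biUnion fun w _ => finite_neighbors hX w).subset ?_
    rintro u ⟨hu, h⟩
    obtain ⟨w, huw, hw⟩ := I.exists_lower hu h
    exact Set.mem_biUnion (show w ∈ {u | {u} ∈ X.faces ∧ l u = k} from ⟨huw.right, hw⟩) huw.symm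

/-- Rays form a closed subset of the product of the finite spheres. -/
theorem IsLevel.compactSpace_geodesicRay (I : X.IsLevel v l) (hX : X.IsLocallyFinite) :
    CompactSpace (X.graph.GeodesicRay v) := by
  let _ : TopologicalSpace V := ⊥
  have : DiscreteTopology V := ⟨rfl⟩
  have hind : Topology.IsInducing (fun (c : X.graph.GeodesicRay v) => c.1) := ⟨rfl⟩
  refine ⟨hind.isCompact_iff.mpr ?_⟩
  have hK : IsCompact (Set.univ.pi fun k => {u | {u} ∈ X.faces ∧ l u = k} : Set (ℕ → V)) :=
    isCompact_univ_pi fun k => (I.finite_sphere hX k).isCompact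
  refine hK.of_isClosed_subset ?_ ?_
  · have : (fun (c : X.graph.GeodesicRay v) => c.1) '' Set.univ =
        {c | c 0 = v} ∩ ⋂ i, ⋂ j, {c | X.graph.dist (c i) (c (i + j)) = j} := by
      ext c
      simp only [Set.mem_inter_iff, Set.mem_iInter, Set.mem_ofPred_eq]
      exact ⟨by rintro ⟨c, -, rfl⟩; exact c.2, fun h => ⟨⟨c, h⟩, trivial, rfl⟩⟩
    rw [this]
    refine (isClosed_eq (continuous_apply 0) continuous_const).inter
      (isClosed_iInter fun i => isClosed_iInter fun j => ?_)
    have hc : Continuous fun c : ℕ → V => (c i, c (i + j)) :=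
      (continuous_apply i).prodMk (continuous_apply (i + j))
    exact (isClosed_discrete {p : V × V | X.graph.dist p.1 p.2 = j}).preimage hc
  · rintro _ ⟨c, -, rfl⟩ k -
    have := I.isAscending_of_dist c.2.1 c.2.2 k
    exact ⟨this.2.left, this.1⟩

theorem isClosed_edge_geodesicRay (v : V) (M : ℕ) :
    IsClosed {p : X.graph.GeodesicRay v × X.graph.GeodesicRay v | X.Edge (p.1.1 M) (p.2.1 M)} := by
  let _ : TopologicalSpace V := ⊥
  have : DiscreteTopology V := ⟨rfl⟩
  have hc : Continuous (fun c : X.graph.GeodesicRay v => c.1 M) :=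
    (continuous_apply M).comp continuous_induced_dom
  exact (isClosed_discrete {p : V × V | X.Edge p.1 p.2}).preimage
    ((hc.comp continuous_fst).prodMk (hc.comp continuous_snd))

theorem IsLevel.connectedSpace_idealBoundary (I : X.IsLevel v l) (H : X.LocallyLarge)
    (hX : X.IsChamberComplex n) (hn : 2 ≤ n) (hfin : X.IsLocallyFinite)
    (hR : ∀ w, {w} ∈ X.faces → X.ConditionR w) :
    ConnectedSpace (X.graph.IdealBoundary v) := by
  have hasc : ∀ c : X.graph.GeodesicRay v, X.IsAscending l c.1 := fun c =>
    I.isAscending_of_dist c.2.1 c.2.2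
  have hray : ∀ {M z}, {z} ∈ X.faces → l z = M → ∃ c : X.graph.GeodesicRay v, c.1 M = z := by
    intro M z hz hM
    obtain ⟨c, hc, hcM⟩ := I.exists_ascending H hX (by omega) hz hM
    exact ⟨⟨c, I.dist_of_isAscending hc⟩, hcM⟩
  obtain ⟨c₀, -⟩ := hray I.vert ((I.eq_zero I.vert).mpr rfl)
  have hcomp := I.compactSpace_geodesicRay hfin
  let π : X.graph.GeodesicRay v → X.graph.IdealBoundary v :=
    Quotient.mk (X.graph.asymptoticSetoid v)
  have hπ : Continuous π := continuous_quot_mk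
  have : Nonempty (X.graph.IdealBoundary v) := ⟨π c₀⟩
  have : PreconnectedSpace (X.graph.IdealBoundary v) := by
    rw [preconnectedSpace_iff_clopen]
    intro s hs
    by_contra! hcon
    obtain ⟨hs1, hs2⟩ := hcon
    obtain ⟨a, ha⟩ := hs1
    obtain ⟨b, hb⟩ := (Set.ne_univ_iff_exists_notMem s).mp hs2
    obtain ⟨c, rfl⟩ := Quotient.exists_rep a
    obtain ⟨d, rfl⟩ := Quotient.exists_rep b
    -- Pairs of rays on opposite sides of the splitting, adjacent or equal at level `M + 1`; the
    -- shift keeps the radius positive, as `sphere_connected` requires. The sets decrease by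
    -- `edge_of_le`.
    let D : ℕ → Set (X.graph.GeodesicRay v × X.graph.GeodesicRay v) := fun M =>
      {p | X.Edge (p.1.1 (M + 1)) (p.2.1 (M + 1))} ∩ (π ⁻¹' s) ×ˢ (π ⁻¹' sᶜ)
    have hclosed : ∀ M, IsClosed (D M) := fun M =>
      (isClosed_edge_geodesicRay v (M + 1)).inter
        ((hs.1.preimage hπ).prod (hs.compl.1.preimage hπ))
    have hne : ∀ M, (D M).Nonempty := by
      intro M
      by_contra hD
      have hD' : ∀ e f : X.graph.GeodesicRay v, X.Edge (e.1 (M + 1)) (f.1 (M + 1)) →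
          π e ∈ s → π f ∈ s := by
        intro e f hef he
        by_contra hf
        exact hD ⟨(e, f), hef, he, hf⟩
      have hchain := I.sphere_connected H hX hn hfin hR (hasc c (M + 1)).2.left
        (hasc d (M + 1)).2.left (hasc c (M + 1)).1 (hasc d (M + 1)).1
      -- If `D M` were empty, membership in `s` would spread from `c` along the connected sphere to
      -- every ray, including `d`.
      have key : ∀ x, ReflTransGen (X.SphereAdj l (M + 1)) (c.1 (M + 1)) x →
          ∀ e : X.graph.GeodesicRay v, e.1 (M + 1) = x → π e ∈ s := by
        intro x hx
        induction hx with
        | refl =>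
          intro e he
          exact hD' c e (by rw [he]; exact edge_self (hasc c (M + 1)).2.left) ha
        | tail _ hbc ih =>
          intro e he
          obtain ⟨f, hf⟩ := hray hbc.2.2.left hbc.1
          exact hD' f e (by rw [hf, he]; exact hbc.2.2) (ih f hf)
      exact hb (key _ hchain d rfl)
    obtain ⟨p, hp⟩ := IsCompact.nonempty_iInter_of_sequence_nonempty_isCompact_isClosed D
      (fun M p hp => ⟨I.edge_of_le H (hasc p.1) (hasc p.2) (Nat.le_succ _) hp.1, hp.2⟩) hne
      (hclosed 0).isCompact hclosed
    rw [Set.mem_iInter] at hp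
    have heq : π p.1 = π p.2 := Quotient.sound ⟨1, fun k =>
      (I.edge_of_le H (hasc p.1) (hasc p.2) (Nat.le_succ k) (hp k).1).dist_le_one⟩
    exact (hp 0).2.2 (heq ▸ (hp 0).2.1)
  exact { toPreconnectedSpace := this, toNonempty := ‹_› }

end PreAbstractSimplicialComplex

theorem theorem2 {V : Type*} (X : PreAbstractSimplicialComplex V) (n : ℕ) (hn : 2 ≤ n)
    (hchamber : X.IsChamberComplex n) (hfin : X.IsLocallyFinite) (hsys : X.IsSystolic 7)
    (hR : ∀ w : V, {w} ∈ X.faces → X.ConditionR w) :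
    ∀ v : V, {v} ∈ X.faces → ConnectedSpace (X.graph.IdealBoundary v) := by
  intro v hv
  have H : X.LocallyLarge := fun w hw => hsys.1 {w} hw
  obtain ⟨l, I⟩ := PreAbstractSimplicialComplex.exists_isLevel H hsys.2.2 hv
  exact I.connectedSpace_idealBoundary H hchamber hn hfin hR
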